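/- Let $n\ge 1$, $0<\alpha\le 1$, and let $\Phi:(0,\infty)\to(0,\infty)$ be an increasing (not necessarily strictly) function for which there is a constant $D$ with $1\le D<2^n$ and $\Phi(2r)\le D\,\Phi(r)$ for all $r>0$. Let $L^{1,\Phi}(\mathbb R^n)$ be the space of all locally integrable (real- or complex-valued) functions $f$ on $\mathbb R^n$ for which there is a finite constant $K\ge 0$ with $$\int_{B(x_0,r)}|f(x)|\,dx\le K\,\Phi(r)\qquad\text{for all }x_0\in\mathbb R^n,\ r>0,$$ where $B(x_0,r)=\{x:|x-x_0|<r\}$; the smallest such $K$ is $\|f\|_{L^{1,\Phi}}$. Let $WL^{1,\Phi}(\mathbb R^n)$ be the space of all measurable, almost everywhere finite functions $g$ for which there is a finite constant $K\ge 0$ with $$\sup_{\lambda>0}\lambda\,\bigl|\{x\in B(x_0,r):|g(x)|>\lambda\}\bigr|\le K\,\Phi(r)\qquad\text{for all }x_0\in\mathbb R^n,\ r>0;$$ the smallest such $K$ is $\|g\|_{WL^{1,\Phi}}$. Let $\mathcal C_\alpha$ be the family of functions $\varphi:\mathbb R^n\to\mathbb R$ that vanish outside $\{|x|\le 1\}$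 and satisfy $\int_{\mathbb R^n}\varphi(x)\,dx=0$ and $|\varphi(x)-\varphi(x')|\le|x-x'|^\alpha$ for all $x,x'\in\mathbb R^n$. Put $\varphi_t(x)=t^{-n}\varphi(x/t)$ for $t>0$. For $f$ locally integrable on $\mathbb R^n$, define $$A_\alpha(f)(y,t)=\sup_{\varphi\in\mathcal C_\alpha}\Bigl|\int_{\mathbb R^n}\varphi_t(y-z)f(z)\,dz\Bigr|\quad(y\in\mathbb R^n,\ t>0),$$ $$\mathcal S_\alpha(f)(x)=\Bigl(\iint_{\{(y,t):\,t>0,\ |x-y|<t\}}A_\alpha(f)(y,t)^2\,\frac{dy\,dt}{t^{n+1}}\Bigr)^{1/2}\in[0,\infty].$$ Then there is a constant $C>0$, independent of $f$, such that for every $f\in L^{1,\Phi}(\mathbb R^n)$ the function $\mathcal S_\alpha(f)$ belongs to $WL^{1,\Phi}(\mathbb R^n)$ and $$\|\mathcal S_\alpha(f)\|_{WL^{1,\Phi}}\le C\,\|f\|_{L^{1,\Phi}}.$$ -/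

import Mathlib

open MeasureTheory
open scoped ENNReal

noncomputable section

namespace IntrinsicSquare

/-- `ℝⁿ` with its Euclidean norm and Lebesgue measure. -/
abbrev Rn (n : ℕ) : Type := EuclideanSpace ℝ (Fin n)

/-- The family `𝒞_α` of real functions supported in the closed unit ball, with integral zero and
with `|φ(x) - φ(x')| ≤ |x - x'|^α` for all `x, x'`. -/
def testFamily (n : ℕ) (α : ℝ) : Set (Rn n → ℝ) :=
  {φ | Function.support φ ⊆ Metric.closedBall 0 1 ∧ ∫ x, φ x = 0 ∧
    ∀ x x', |φ x - φ x'| ≤ ‖x - x'‖ ^ α}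

/-- The dilation `φ_t(x) = t⁻ⁿ φ(x / t)`. -/
def dilate {n : ℕ} (φ : Rn n → ℝ) (t : ℝ) : Rn n → ℝ :=
  fun x => (t ^ n)⁻¹ * φ (t⁻¹ • x)

/-- `A_α(f)(y,t) = sup_{φ ∈ 𝒞_α} |∫ φ_t(y - z) f(z) dz|`, as an element of `[0, ∞]`. -/
def A {n : ℕ} {𝕜 : Type*} [RCLike 𝕜] (α : ℝ) (f : Rn n → 𝕜) (y : Rn n) (t : ℝ) : ℝ≥0∞ :=
  ⨆ φ ∈ testFamily n α, ‖∫ z, dilate φ t (y - z) • f z‖ₑ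

/-- The cone `Γ(x) = {(y,t) : t > 0, |x - y| < t}`. -/
def cone {n : ℕ} (x : Rn n) : Set (Rn n × ℝ) :=
  {q | 0 < q.2 ∧ ‖x - q.1‖ < q.2}

/-- The intrinsic square function
`S_α(f)(x) = (∬_{Γ(x)} A_α(f)(y,t)² dy dt / t^(n+1))^(1/2)`, with values in `[0, ∞]`. -/
def S {n : ℕ} {𝕜 : Type*} [RCLike 𝕜] (α : ℝ) (f : Rn n → 𝕜) (x : Rn n) : ℝ≥0∞ :=
  (∫⁻ q in cone x, A α f q.1 q.2 ^ 2 / ENNReal.ofReal (q.2 ^ (n + 1))) ^ (1 / 2 : ℝ)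

/-- `Φ` is a growth function: positive and increasing (not necessarily strictly) on `(0, ∞)`, and
doubling with constant `D ≥ 1`. Only the values of `Φ` on `(0, ∞)` matter. -/
structure IsGrowth (Φ : ℝ → ℝ) (D : ℝ) : Prop where
  pos : ∀ r, 0 < r → 0 < Φ r
  mono : MonotoneOn Φ (Set.Ioi 0)
  one_le : 1 ≤ D
  doubling : ∀ r, 0 < r → Φ (2 * r) ≤ D * Φ r

/-- The norm of `L^{p,Φ}`: the smallest `C ∈ [0, ∞]` with `∫_{B(x₀,r)} |f|^p ≤ C^p Φ(r)` for all
balls. -/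
def morreyNorm {n : ℕ} {𝕜 : Type*} [RCLike 𝕜] (p : ℝ) (Φ : ℝ → ℝ) (f : Rn n → 𝕜) : ℝ≥0∞ :=
  sInf {C | ∀ (x₀ : Rn n) (r : ℝ), 0 < r →
    ∫⁻ x in Metric.ball x₀ r, ‖f x‖ₑ ^ p ≤ C ^ p * ENNReal.ofReal (Φ r)}

/-- Membership in the generalized Morrey space `L^{p,Φ}`. -/
def MemMorrey {n : ℕ} {𝕜 : Type*} [RCLike 𝕜] (p : ℝ) (Φ : ℝ → ℝ) (f : Rn n → 𝕜) : Prop :=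
  LocallyIntegrable f ∧ morreyNorm p Φ f < ∞

/-- The norm of `WL^{1,Φ}`, for a function `g` with values in `[0, ∞]` (for a scalar function, take
its absolute value): the smallest `C ∈ [0, ∞]` with `l * |{x ∈ B(x₀,r) : g(x) > l}| ≤ C Φ(r)` for
all `l > 0` and all balls. -/
def weakMorreyNorm {n : ℕ} (Φ : ℝ → ℝ) (g : Rn n → ℝ≥0∞) : ℝ≥0∞ :=
  sInf {C | ∀ (x₀ : Rn n) (r : ℝ), 0 < r → ∀ l : ℝ, 0 < l →
    ENNReal.ofReal l * volume {x ∈ Metric.ball x₀ r | ENNReal.ofReal l < g x}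
      ≤ C * ENNReal.ofReal (Φ r)}

/-- Membership in the generalized weak Morrey space `WL^{1,Φ}`: (Lebesgue) measurable, finite
almost everywhere, and of finite weak norm. -/
def MemWeakMorrey {n : ℕ} (Φ : ℝ → ℝ) (g : Rn n → ℝ≥0∞) : Prop :=
  AEMeasurable g ∧ (∀ᵐ x, g x < ∞) ∧ weakMorreyNorm Φ g < ∞

end IntrinsicSquare

end

/-!
# The intrinsic square function on generalized Morrey spaces

A ball `B(x₀, r)` splits `f` into its part `f₁` inside `B(x₀, 2r)` and its part `f₂` outside.

For `f₁` the weak `(1,1)` inequality `mul_volume_lt_S_le` applies, together with one doubling of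
`Φ`. For `f₂` and `x ∈ B(x₀, r)`, only heights `t > r/2` in the cone over `x` contribute, and there
`A_α(f₂)(y,t)` is at most `3 t⁻ⁿ` times the integral of `|f|` over `B(y, 2t)`. Since `Φ` grows at
most like a power of exponent `log₂ D < n`, the integral over `t` converges, and `S_α(f₂)` is
bounded on `B(x₀, r)` by a multiple of `Φ(r) / rⁿ` (`S_indicator_compl_ball_le`).

The weak `(1,1)` inequality follows from an `L²` bound and a Calderón–Zygmund decomposition.

* The `L²` bound (`lintegral_S_sq_le`) comes from the `T T*` method. The supremum over `𝒞_α` is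
  replaced by a measurable choice of one test function at each point `(y,t)`, which is possible
  since countably many test functions suffice (`exists_seq_A_eq_iSup`). Two test functions at
  scales `t ≤ t'` have inner product at most a constant times `t'⁻ⁿ (t/t')^α`, because the first
  one has mean zero and the second one is Hölder continuous. Schur's test
  (`lintegral_integral_sq_le_of_schur`) then bounds the resulting linear operator,
  whatever the choice of test functions was.
* The decomposition (`exists_calderonZygmund`) uses balls instead of dyadic cubes. Vitali's covering
  lemma gives disjoint balls on which the average of `|f|` exceeds the height, while their
  enlargements have small averages and cover the set where `|f|` is large. The atoms have integral
  zero, so that their square functions are integrable away from their supports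
  (`setLIntegral_S_le_of_integral_eq_zero`).
-/

namespace IntrinsicSquare

open Filter Topology Metric

variable {n : ℕ} {𝕜 : Type*} [RCLike 𝕜] {α : ℝ}

/-! ### Test functions and the maximal quantity `A_α` -/

theorem testFamily.continuous (hα₀ : 0 < α) {φ : Rn n → ℝ} (hφ : φ ∈ testFamily n α) :
    Continuous φ := by
  rw [continuous_iff_continuousAt]
  intro x
  rw [ContinuousAt, tendsto_iff_norm_sub_tendsto_zero]
  refine squeeze_zero (fun _ => norm_nonneg _) (fun y => hφ.2.2 y x) ?_
  have h : Tendsto (fun y : Rn n => ‖y - x‖) (𝓝 x) (𝓝 0) := by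
    have : Continuous fun y : Rn n => ‖y - x‖ := by fun_prop
    simpa using this.tendsto x
  simpa [Real.zero_rpow hα₀.ne'] using h.rpow_const (p := α) (Or.inr hα₀.le)

theorem testFamily.abs_le [NeZero n] (hα₀ : 0 < α) (hα₁ : α ≤ 1) {φ : Rn n → ℝ}
    (hφ : φ ∈ testFamily n α) (x : Rn n) : |φ x| ≤ 3 := by
  by_cases hx : x ∈ closedBall (0 : Rn n) 1
  · -- Compare with a point of norm `2`, where `φ` vanishes.
    set e : Rn n := EuclideanSpace.single 0 (2 : ℝ) with he
    have hen : ‖e‖ = 2 := by simp [he]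
    have he0 : φ e = 0 := by
      by_contra h
      have := hφ.1 (Function.mem_support.2 h)
      rw [mem_closedBall_zero_iff, hen] at this
      norm_num at this
    have h := hφ.2.2 x e
    rw [he0, sub_zero] at h
    refine h.trans ?_
    rw [mem_closedBall_zero_iff] at hx
    have h3 : ‖x - e‖ ≤ 3 := (norm_sub_le _ _).trans (by rw [hen]; linarith)
    calc ‖x - e‖ ^ α ≤ (3 : ℝ) ^ α := Real.rpow_le_rpow (norm_nonneg _) h3 hα₀.le
      _ ≤ (3 : ℝ) ^ (1 : ℝ) := Real.rpow_le_rpow_of_exponent_le (by norm_num) hα₁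
      _ = 3 := by simp
  · have : φ x = 0 := by
      by_contra h
      exact hx (hφ.1 (Function.mem_support.2 h))
    simp [this]

theorem zero_mem_testFamily : (0 : Rn n → ℝ) ∈ testFamily n α := by
  refine ⟨by simp, by simp, fun x x' => ?_⟩
  simpa using Real.rpow_nonneg (norm_nonneg _) _

theorem dilate_eq_zero {φ : Rn n → ℝ} (hφ : φ ∈ testFamily n α) {t : ℝ} (ht : 0 < t)
    {x : Rn n} (hx : t < ‖x‖) : dilate φ t x = 0 := by
  have : φ (t⁻¹ • x) = 0 := by
    by_contra h
    have := hφ.1 (Function.mem_support.2 h)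
    rw [mem_closedBall_zero_iff, norm_smul, norm_inv, Real.norm_of_nonneg ht.le,
      inv_mul_le_iff₀ ht] at this
    linarith
  simp [dilate, this]

theorem abs_dilate_le [NeZero n] (hα₀ : 0 < α) (hα₁ : α ≤ 1) {φ : Rn n → ℝ}
    (hφ : φ ∈ testFamily n α) {t : ℝ} (ht : 0 < t) (x : Rn n) :
    |dilate φ t x| ≤ 3 * (t ^ n)⁻¹ := by
  rw [dilate, abs_mul, abs_of_pos (by positivity), mul_comm]
  gcongr
  exact testFamily.abs_le hα₀ hα₁ hφ _

theorem abs_dilate_sub_le {φ : Rn n → ℝ}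
    (hφ : φ ∈ testFamily n α) {t : ℝ} (ht : 0 < t) (x x' : Rn n) :
    |dilate φ t x - dilate φ t x'| ≤ (t ^ n)⁻¹ * (‖x - x'‖ / t) ^ α := by
  rw [dilate, dilate, ← mul_sub, abs_mul, abs_of_pos (by positivity)]
  gcongr
  refine (hφ.2.2 _ _).trans_eq ?_
  rw [← smul_sub, norm_smul, norm_inv, Real.norm_of_nonneg ht.le, inv_mul_eq_div]

theorem continuous_dilate (hα₀ : 0 < α) {φ : Rn n → ℝ} (hφ : φ ∈ testFamily n α) (t : ℝ) :
    Continuous (dilate φ t) :=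
  continuous_const.mul ((testFamily.continuous hα₀ hφ).comp (continuous_const_smul _))

theorem integral_dilate {φ : Rn n → ℝ} (hφ : φ ∈ testFamily n α) (t : ℝ) (y : Rn n) :
    ∫ z, dilate φ t (y - z) = 0 := by
  rw [integral_sub_left_eq_self (fun z => dilate φ t z) volume y]
  simp only [dilate]
  rw [integral_const_mul, Measure.integral_comp_inv_smul, hφ.2.1]
  simp

theorem hasCompactSupport_dilate {φ : Rn n → ℝ} (hφ : φ ∈ testFamily n α) {t : ℝ} (ht : 0 < t)
    (y : Rn n) : HasCompactSupport fun z => dilate φ t (y - z) := by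
  refine HasCompactSupport.intro (isCompact_closedBall y t) fun z hz => dilate_eq_zero hφ ht ?_
  rw [mem_closedBall, dist_comm, dist_eq_norm, not_le] at hz
  exact hz

theorem integrable_dilate_smul (hα₀ : 0 < α) {f : Rn n → 𝕜} (hf : LocallyIntegrable f)
    {φ : Rn n → ℝ} (hφ : φ ∈ testFamily n α) {t : ℝ} (ht : 0 < t) (y : Rn n) :
    Integrable fun z => dilate φ t (y - z) • f z :=
  hf.integrable_smul_left_of_hasCompactSupport
    ((continuous_dilate hα₀ hφ t).comp (continuous_const.sub continuous_id))
    (hasCompactSupport_dilate hφ ht y)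

theorem enorm_le_A {f : Rn n → 𝕜} {φ : Rn n → ℝ} (hφ : φ ∈ testFamily n α) (y : Rn n) (t : ℝ) :
    ‖∫ z, dilate φ t (y - z) • f z‖ₑ ≤ A α f y t :=
  le_iSup₂ (f := fun φ (_ : φ ∈ testFamily n α) => ‖∫ z, dilate φ t (y - z) • f z‖ₑ) φ hφ

theorem A_le_setLIntegral [NeZero n] (hα₀ : 0 < α) (hα₁ : α ≤ 1) (f : Rn n → 𝕜) (y : Rn n)
    {t : ℝ} (ht : 0 < t) :
    A α f y t ≤ ENNReal.ofReal (3 * (t ^ n)⁻¹) * ∫⁻ z in closedBall y t, ‖f z‖ₑ := by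
  refine iSup₂_le fun φ hφ => (enorm_integral_le_lintegral_enorm _).trans ?_
  rw [← lintegral_const_mul' _ _ ENNReal.ofReal_ne_top,
    ← lintegral_indicator measurableSet_closedBall]
  refine lintegral_mono fun z => ?_
  by_cases hz : z ∈ closedBall y t
  · rw [Set.indicator_of_mem hz, enorm_smul]
    gcongr
    rw [Real.enorm_eq_ofReal_abs]
    exact ENNReal.ofReal_le_ofReal (abs_dilate_le hα₀ hα₁ hφ ht _)
  · rw [mem_closedBall, dist_comm, dist_eq_norm, not_le] at hz
    simp [dilate_eq_zero hφ ht hz]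

theorem A_eq_zero {f : Rn n → 𝕜} {y : Rn n} {t : ℝ} (ht : 0 < t)
    (h : ∀ z ∈ closedBall y t, f z = 0) : A α f y t = 0 := by
  refine le_antisymm (iSup₂_le fun φ hφ => ?_) bot_le
  have : ∀ z, dilate φ t (y - z) • f z = 0 := fun z => by
    by_cases hz : z ∈ closedBall y t
    · simp [h z hz]
    · rw [mem_closedBall, dist_comm, dist_eq_norm, not_le] at hz
      simp [dilate_eq_zero hφ ht hz]
  simp [this]

theorem A_congr_ae {f g : Rn n → 𝕜} (h : f =ᵐ[volume] g) (y : Rn n) (t : ℝ) :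
    A α f y t = A α g y t := by
  have (φ : Rn n → ℝ) : ∫ z, dilate φ t (y - z) • f z = ∫ z, dilate φ t (y - z) • g z := by
    refine integral_congr_ae ?_
    filter_upwards [h] with z hz
    rw [hz]
  simp only [A, this]

theorem A_add_le (hα₀ : 0 < α) {f g : Rn n → 𝕜} (hf : LocallyIntegrable f)
    (hg : LocallyIntegrable g) (y : Rn n) {t : ℝ} (ht : 0 < t) :
    A α (f + g) y t ≤ A α f y t + A α g y t := by
  refine iSup₂_le fun φ hφ => ?_
  have : ∫ z, dilate φ t (y - z) • (f + g) z
      = (∫ z, dilate φ t (y - z) • f z) + ∫ z, dilate φ t (y - z) • g z := by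
    rw [← integral_add (integrable_dilate_smul hα₀ hf hφ ht y)
      (integrable_dilate_smul hα₀ hg hφ ht y)]
    simp
  rw [this]
  exact (enorm_add_le _ _).trans (add_le_add (enorm_le_A hφ y t) (enorm_le_A hφ y t))

/-- Countable subadditivity of `A_α`, for an `L¹`-summable family. -/
theorem A_tsum_le [NeZero n] (hα₀ : 0 < α) (hα₁ : α ≤ 1) {ι : Type*} [Countable ι]
    {b : ι → Rn n → 𝕜}
    (hb : ∀ i, Integrable (b i)) (hsum : ∑' i, ∫⁻ z, ‖b i z‖ₑ ≠ ∞) (y : Rn n) {t : ℝ}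
    (ht : 0 < t) :
    A α (fun z => ∑' i, b i z) y t ≤ ∑' i, A α (b i) y t := by
  refine iSup₂_le fun φ hφ => ?_
  have hae : ∀ᵐ z, Summable fun i => b i z := by
    have h1 : ∫⁻ z, ∑' i, ‖b i z‖ₑ ≠ ∞ := by
      rwa [lintegral_tsum fun i => (hb i).1.enorm]
    filter_upwards [ae_lt_top' (AEMeasurable.tsum fun i => (hb i).1.enorm) h1] with z hz
    exact Summable.of_enorm hz.ne
  have : ∫ z, dilate φ t (y - z) • ∑' i, b i z = ∑' i, ∫ z, dilate φ t (y - z) • b i z := by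
    rw [← integral_tsum]
    · refine integral_congr_ae ?_
      filter_upwards [hae] with z hz
      rw [hz.tsum_const_smul]
    · exact fun i => (integrable_dilate_smul hα₀ (hb i).locallyIntegrable hφ ht y).1
    · refine ne_top_of_le_ne_top (ENNReal.mul_ne_top ENNReal.ofReal_ne_top hsum)
        (b := ENNReal.ofReal (3 * (t ^ n)⁻¹) * ∑' i, ∫⁻ z, ‖b i z‖ₑ) ?_
      rw [← ENNReal.tsum_mul_left]
      refine ENNReal.tsum_le_tsum fun i => ?_
      rw [← lintegral_const_mul' _ _ ENNReal.ofReal_ne_top]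
      refine lintegral_mono fun z => ?_
      rw [enorm_smul]
      gcongr
      rw [Real.enorm_eq_ofReal_abs]
      exact ENNReal.ofReal_le_ofReal (abs_dilate_le hα₀ hα₁ hφ ht _)
  rw [this]
  refine (enorm_tsum_le_tsum_enorm ).trans (ENNReal.tsum_le_tsum fun i => enorm_le_A hφ y t)

/-- The gain from cancellation: if `b` has integral zero and lives in a ball of radius `ρ`, the
Hölder condition makes `A_α(b)(y,t)` smaller by a factor `(ρ/t)^α`. -/
theorem A_le_of_integral_eq_zero (hα₀ : 0 < α) {b : Rn n → 𝕜} (hb : Integrable b)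
    (hb0 : ∫ z, b z = 0) {c : Rn n} {ρ : ℝ} (hρ : ∀ z ∉ closedBall c ρ, b z = 0)
    (y : Rn n) {t : ℝ} (ht : 0 < t) :
    A α b y t ≤ ENNReal.ofReal ((t ^ n)⁻¹ * (ρ / t) ^ α) * ∫⁻ z, ‖b z‖ₑ := by
  refine iSup₂_le fun φ hφ => ?_
  have : ∫ z, dilate φ t (y - z) • b z
      = ∫ z, (dilate φ t (y - z) - dilate φ t (y - c)) • b z := by
    have h1 : Integrable fun z => dilate φ t (y - c) • b z :=
      hb.smul (dilate φ t (y - c))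
    simp_rw [sub_smul]
    rw [integral_sub (integrable_dilate_smul hα₀ hb.locallyIntegrable hφ ht y) h1,
      integral_smul, hb0]
    simp
  rw [this, ← lintegral_const_mul' _ _ ENNReal.ofReal_ne_top]
  refine (enorm_integral_le_lintegral_enorm _).trans (lintegral_mono fun z => ?_)
  by_cases hz : z ∈ closedBall c ρ
  · rw [enorm_smul]
    gcongr
    rw [Real.enorm_eq_ofReal_abs]
    refine ENNReal.ofReal_le_ofReal ((abs_dilate_sub_le hφ ht _ _).trans ?_)
    gcongr
    rw [mem_closedBall, dist_comm, dist_eq_norm] at hz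
    simpa using hz
  · simp [hρ z hz]

/-- A countable subfamily of `𝒞_α` computes `A_α`, because `𝒞_α` is separable for locally uniform
convergence. -/
theorem exists_seq_A_eq_iSup [NeZero n] (𝕜 : Type*) [RCLike 𝕜] (hα₀ : 0 < α) (hα₁ : α ≤ 1) :
    ∃ u : ℕ → Rn n → ℝ, (∀ i, u i ∈ testFamily n α) ∧
      ∀ (f : Rn n → 𝕜), LocallyIntegrable f → ∀ (y : Rn n) (t : ℝ), 0 < t →
        A α f y t = ⨆ i, ‖∫ z, dilate (u i) t (y - z) • f z‖ₑ := by
  have : Nonempty {g : C(Rn n, ℝ) | ⇑g ∈ testFamily n α} := ⟨⟨0, zero_mem_testFamily⟩⟩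
  have := TopologicalSpace.Subtype.secondCountableTopology {g : C(Rn n, ℝ) | ⇑g ∈ testFamily n α}
  obtain ⟨u, hu⟩ := TopologicalSpace.exists_dense_seq {g : C(Rn n, ℝ) | ⇑g ∈ testFamily n α}
  refine ⟨fun i => (u i).1, fun i => (u i).2, fun f hf y t ht => le_antisymm ?_ ?_⟩
  · refine iSup₂_le fun φ hφ => ?_
    let g : {g : C(Rn n, ℝ) | ⇑g ∈ testFamily n α} := ⟨⟨φ, testFamily.continuous hα₀ hφ⟩, hφ⟩
    obtain ⟨v, hv, hlim⟩ := mem_closure_iff_seq_limit.1 (hu g)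
    have hpt : ∀ x, Tendsto (fun k => (v k).1 x) atTop (𝓝 (φ x)) := fun x =>
      (((continuous_eval_const x).comp continuous_subtype_val).tendsto g).comp hlim
    have hT : Tendsto (fun k => ∫ z, dilate (v k).1 t (y - z) • f z) atTop
        (𝓝 (∫ z, dilate φ t (y - z) • f z)) := by
      refine tendsto_integral_of_dominated_convergence
        (fun z => (closedBall y t).indicator (fun z => 3 * (t ^ n)⁻¹ * ‖f z‖) z) ?_ ?_ ?_ ?_
      · exact fun k => (integrable_dilate_smul hα₀ hf (v k).2 ht y).1
      · rw [integrable_indicator_iff measurableSet_closedBall]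
        exact ((hf.integrableOn_isCompact (isCompact_closedBall y t)).norm.const_mul _)
      · intro k
        refine ae_of_all _ fun z => ?_
        by_cases hz : z ∈ closedBall y t
        · rw [Set.indicator_of_mem hz, norm_smul]
          gcongr
          exact abs_dilate_le hα₀ hα₁ (v k).2 ht _
        · rw [Set.indicator_of_notMem hz]
          rw [mem_closedBall, dist_comm, dist_eq_norm, not_le] at hz
          simp [dilate_eq_zero (v k).2 ht hz]
      · refine ae_of_all _ fun z => Tendsto.smul_const ?_ _
        exact (hpt _).const_mul _
    refine le_of_tendsto' hT.enorm fun k => ?_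
    obtain ⟨i, hi⟩ := hv k
    rw [← hi]
    exact le_iSup (fun i => ‖∫ z, dilate (u i).1 t (y - z) • f z‖ₑ) i
  · exact iSup_le fun i => enorm_le_A (u i).2 y t

theorem measurable_dilate_uncurry (hα₀ : 0 < α) {φ : Rn n → ℝ} (hφ : φ ∈ testFamily n α) :
    Measurable fun p : (Rn n × ℝ) × Rn n => dilate φ p.1.2 (p.1.1 - p.2) := by
  have := (testFamily.continuous hα₀ hφ).measurable
  unfold dilate
  fun_prop

theorem measurable_integral_dilate (hα₀ : 0 < α) {f : Rn n → 𝕜} (hf : AEStronglyMeasurable f)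
    {φ : Rn n → ℝ} (hφ : φ ∈ testFamily n α) :
    Measurable fun q : Rn n × ℝ => ∫ z, dilate φ q.2 (q.1 - z) • f z := by
  have : (fun q : Rn n × ℝ => ∫ z, dilate φ q.2 (q.1 - z) • f z)
      = fun q => ∫ z, dilate φ q.2 (q.1 - z) • hf.mk f z := by
    funext q
    refine integral_congr_ae ?_
    filter_upwards [hf.ae_eq_mk] with z hz
    rw [hz]
  rw [this]
  have h1 : StronglyMeasurable fun p : (Rn n × ℝ) × Rn n =>
      dilate φ p.1.2 (p.1.1 - p.2) • hf.mk f p.2 :=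
    (measurable_dilate_uncurry hα₀ hφ).stronglyMeasurable.smul
      (hf.stronglyMeasurable_mk.comp_measurable measurable_snd)
  exact h1.integral_prod_right.measurable

/-- `A_α(f)` agrees on the upper half space with a measurable function. -/
theorem exists_measurable_eq_A [NeZero n] (hα₀ : 0 < α) (hα₁ : α ≤ 1) {f : Rn n → 𝕜}
    (hf : LocallyIntegrable f) :
    ∃ F : Rn n × ℝ → ℝ≥0∞, Measurable F ∧ ∀ q, 0 < q.2 → A α f q.1 q.2 = F q := by
  obtain ⟨u, hu, hA⟩ := exists_seq_A_eq_iSup (n := n) 𝕜 hα₀ hα₁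
  refine ⟨fun q => ⨆ i, ‖∫ z, dilate (u i) q.2 (q.1 - z) • f z‖ₑ, ?_, fun q hq => hA f hf _ _ hq⟩
  exact Measurable.iSup fun i =>
    (measurable_integral_dilate hα₀ hf.aestronglyMeasurable (hu i)).enorm

/-! ### The square function as an `L²` norm over cones -/

/-- Minkowski's inequality in `L²` for countable sums of nonnegative functions. -/
theorem lintegral_sq_tsum_le {X : Type*} [MeasurableSpace X] {μ : Measure X} {ι : Type*}
    [Countable ι] {F : ι → X → ℝ≥0∞} (hF : ∀ i, AEMeasurable (F i) μ) :
    (∫⁻ x, (∑' i, F i x) ^ (2 : ℝ) ∂μ) ^ (1 / 2 : ℝ)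
      ≤ ∑' i, (∫⁻ x, F i x ^ (2 : ℝ) ∂μ) ^ (1 / 2 : ℝ) := by
  have hfin (s : Finset ι) : (∫⁻ x, (∑ i ∈ s, F i x) ^ (2 : ℝ) ∂μ) ^ (1 / 2 : ℝ)
      ≤ ∑ i ∈ s, (∫⁻ x, F i x ^ (2 : ℝ) ∂μ) ^ (1 / 2 : ℝ) := by
    classical
    induction s using Finset.induction_on with
    | empty => simp
    | insert i s hi ih =>
      simp only [Finset.sum_insert hi]
      exact (ENNReal.lintegral_Lp_add_le (hF i) (Finset.aemeasurable_fun_sum s fun j _ => hF j)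
        (by norm_num)).trans (add_le_add le_rfl ih)
  have h2 (x : X) : (∑' i, F i x) ^ (2 : ℝ) = ⨆ s : Finset ι, (∑ i ∈ s, F i x) ^ (2 : ℝ) := by
    rw [ENNReal.tsum_eq_iSup_sum]
    exact (ENNReal.orderIsoRpow 2 (by norm_num)).map_iSup _
  simp_rw [h2]
  rw [lintegral_iSup_directed]
  · have := (ENNReal.orderIsoRpow (1 / 2) (by norm_num)).map_iSup
      fun s : Finset ι => ∫⁻ x, (∑ i ∈ s, F i x) ^ (2 : ℝ) ∂μ
    simp only [ENNReal.orderIsoRpow_apply] at this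
    rw [this]
    exact iSup_le fun s => (hfin s).trans (ENNReal.sum_le_tsum s)
  · exact fun s => (Finset.aemeasurable_fun_sum s fun j _ => hF j).pow_const _
  · refine Monotone.directed_le fun s s' hs x => ?_
    exact ENNReal.rpow_le_rpow (Finset.sum_le_sum_of_subset hs) (by norm_num)

theorem measurableSet_cone (x : Rn n) : MeasurableSet (cone x) := by
  apply MeasurableSet.inter
  · exact measurableSet_lt measurable_const measurable_snd
  · exact measurableSet_lt (by fun_prop) measurable_snd

/-- `S_α(f)(x)` as an `L²` norm over the cone with respect to Lebesgue measure. -/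
theorem S_eq (f : Rn n → 𝕜) (x : Rn n) :
    S α f x = (∫⁻ q in cone x, (A α f q.1 q.2 *
      (ENNReal.ofReal (q.2 ^ (n + 1)))⁻¹ ^ (1 / 2 : ℝ)) ^ (2 : ℝ)) ^ (1 / 2 : ℝ) := by
  rw [S]
  congr 2
  funext q
  rw [ENNReal.mul_rpow_of_nonneg _ _ (by norm_num), ← ENNReal.rpow_mul, div_eq_mul_inv]
  norm_num

theorem aemeasurable_A_cone [NeZero n] (hα₀ : 0 < α) (hα₁ : α ≤ 1) {f : Rn n → 𝕜}
    (hf : LocallyIntegrable f) (x : Rn n) :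
    AEMeasurable (fun q : Rn n × ℝ => A α f q.1 q.2 *
      (ENNReal.ofReal (q.2 ^ (n + 1)))⁻¹ ^ (1 / 2 : ℝ)) (volume.restrict (cone x)) := by
  obtain ⟨F, hF, hAF⟩ := exists_measurable_eq_A hα₀ hα₁ hf
  refine AEMeasurable.mul ⟨F, hF, ?_⟩ (by fun_prop)
  filter_upwards [ae_restrict_mem (measurableSet_cone x)] with q hq
  exact hAF q hq.1

theorem S_add_le [NeZero n] (hα₀ : 0 < α) (hα₁ : α ≤ 1) {f g : Rn n → 𝕜}
    (hf : LocallyIntegrable f) (hg : LocallyIntegrable g) (x : Rn n) :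
    S α (f + g) x ≤ S α f x + S α g x := by
  rw [S_eq, S_eq, S_eq]
  refine le_trans ?_ (ENNReal.lintegral_Lp_add_le (aemeasurable_A_cone hα₀ hα₁ hf x)
    (aemeasurable_A_cone hα₀ hα₁ hg x) (by norm_num))
  refine ENNReal.rpow_le_rpow (setLIntegral_mono' (measurableSet_cone x) fun q hq => ?_)
    (by norm_num)
  refine ENNReal.rpow_le_rpow ?_ (by norm_num)
  simp only [Pi.add_apply]
  rw [← add_mul]
  gcongr
  exact A_add_le hα₀ hf hg _ hq.1

theorem S_tsum_le [NeZero n] (hα₀ : 0 < α) (hα₁ : α ≤ 1) {ι : Type*} [Countable ι]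
    {b : ι → Rn n → 𝕜} (hb : ∀ i, Integrable (b i)) (hsum : ∑' i, ∫⁻ z, ‖b i z‖ₑ ≠ ∞)
    (x : Rn n) : S α (fun z => ∑' i, b i z) x ≤ ∑' i, S α (b i) x := by
  simp_rw [S_eq]
  refine le_trans ?_ (lintegral_sq_tsum_le fun i =>
    aemeasurable_A_cone hα₀ hα₁ (hb i).locallyIntegrable x)
  refine ENNReal.rpow_le_rpow (setLIntegral_mono' (measurableSet_cone x) fun q hq => ?_)
    (by norm_num)
  refine ENNReal.rpow_le_rpow ?_ (by norm_num)
  rw [ENNReal.tsum_mul_right]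
  gcongr
  exact A_tsum_le hα₀ hα₁ hb hsum _ hq.1

theorem measurable_indicator_cone {G : Rn n × ℝ → ℝ≥0∞} (hG : Measurable G) :
    Measurable fun p : Rn n × (Rn n × ℝ) => (cone p.1).indicator G p.2 := by
  have hs : MeasurableSet {p : Rn n × (Rn n × ℝ) | p.2 ∈ cone p.1} := by
    have h2 : Measurable fun p : Rn n × (Rn n × ℝ) => p.2.2 := by fun_prop
    have h1 : Measurable fun p : Rn n × (Rn n × ℝ) => ‖p.1 - p.2.1‖ := by fun_prop
    exact (measurableSet_lt measurable_const h2).inter (measurableSet_lt h1 h2)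
  exact (hG.comp measurable_snd).indicator hs

theorem measurable_S [NeZero n] (hα₀ : 0 < α) (hα₁ : α ≤ 1) {f : Rn n → 𝕜}
    (hf : LocallyIntegrable f) : Measurable (S α f) := by
  obtain ⟨F, hF, hAF⟩ := exists_measurable_eq_A hα₀ hα₁ hf
  have h : S α f = fun x => (∫⁻ q, (cone x).indicator
      (fun q => F q ^ 2 / ENNReal.ofReal (q.2 ^ (n + 1))) q) ^ (1 / 2 : ℝ) := by
    funext x
    rw [S, lintegral_indicator (measurableSet_cone x)]
    congr 1
    refine setLIntegral_congr_fun (measurableSet_cone x) fun q hq => ?_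
    simp only [hAF q hq.1]
  rw [h]
  exact (Measurable.lintegral_prod_right'
    (measurable_indicator_cone (by fun_prop))).pow_const _

theorem volume_ball_eq (x : Rn n) {r : ℝ} (hr : 0 < r) :
    volume (ball x r) = ENNReal.ofReal (r ^ n) * volume (ball (0 : Rn n) 1) := by
  rw [Measure.addHaar_ball_of_pos _ _ hr, finrank_euclideanSpace_fin]

theorem volume_closedBall_eq (x : Rn n) {r : ℝ} (hr : 0 < r) :
    volume (closedBall x r) = ENNReal.ofReal (r ^ n) * volume (ball (0 : Rn n) 1) := by
  rw [Measure.addHaar_closedBall _ _ hr.le, finrank_euclideanSpace_fin]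

/-- Fubini: integrating `S_α(f)²` gives the integral of `A_α(f)(y,t)² dy dt / t`. -/
theorem lintegral_S_sq [NeZero n] (hα₀ : 0 < α) (hα₁ : α ≤ 1) {f : Rn n → 𝕜}
    (hf : LocallyIntegrable f) :
    ∫⁻ x, S α f x ^ 2 = volume (ball (0 : Rn n) 1) *
      ∫⁻ q in {q : Rn n × ℝ | 0 < q.2}, A α f q.1 q.2 ^ 2 * ENNReal.ofReal q.2⁻¹ := by
  obtain ⟨F, hF, hAF⟩ := exists_measurable_eq_A hα₀ hα₁ hf
  have hpos : MeasurableSet {q : Rn n × ℝ | 0 < q.2} :=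
    measurableSet_lt measurable_const measurable_snd
  set G : Rn n × ℝ → ℝ≥0∞ := fun q => F q ^ 2 / ENNReal.ofReal (q.2 ^ (n + 1)) with hGdef
  have hG : Measurable G := by fun_prop
  have h1 (x : Rn n) : S α f x ^ 2 = ∫⁻ q, (cone x).indicator G q := by
    rw [S, ← ENNReal.rpow_natCast, ← ENNReal.rpow_mul, lintegral_indicator (measurableSet_cone x)]
    norm_num
    refine setLIntegral_congr_fun (measurableSet_cone x) fun q hq => ?_
    simp only [hGdef, hAF q hq.1]
  simp_rw [h1]
  rw [lintegral_lintegral_swap (measurable_indicator_cone hG).aemeasurable,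
    ← lintegral_const_mul' _ _ measure_ball_lt_top.ne, ← lintegral_indicator hpos]
  refine lintegral_congr fun q => ?_
  by_cases hq : 0 < q.2
  · have h2 (x : Rn n) : (cone x).indicator G q = (ball q.1 q.2).indicator (fun _ => G q) x := by
      by_cases hx : x ∈ ball q.1 q.2
      · rw [Set.indicator_of_mem hx, Set.indicator_of_mem]
        exact ⟨hq, by rwa [mem_ball_iff_norm] at hx⟩
      · rw [Set.indicator_of_notMem hx, Set.indicator_of_notMem]
        exact fun h => hx (by rw [mem_ball_iff_norm]; exact h.2)
    simp_rw [h2]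
    rw [lintegral_indicator_const measurableSet_ball, volume_ball_eq _ hq,
      Set.indicator_of_mem (by exact hq), hAF q hq, hGdef]
    have h3 : (ENNReal.ofReal (q.2 ^ (n + 1)))⁻¹ * ENNReal.ofReal (q.2 ^ n)
        = ENNReal.ofReal q.2⁻¹ := by
      rw [← ENNReal.ofReal_inv_of_pos (by positivity), ← ENNReal.ofReal_mul (by positivity)]
      congr 1
      field_simp
      ring
    simp only
    rw [← h3, div_eq_mul_inv]
    ring
  · have h2 (x : Rn n) : (cone x).indicator G q = 0 :=
      Set.indicator_of_notMem (fun h => hq h.1) _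
    simp [h2, hq]

theorem lintegral_Ioi_rpow {a s : ℝ} (ha : 0 < a) (hs : 0 < s) :
    ∫⁻ t in Set.Ioi a, ENNReal.ofReal (t ^ (-s - 1)) = ENNReal.ofReal (a ^ (-s) / s) := by
  rw [← ofReal_integral_eq_lintegral_ofReal (integrableOn_Ioi_rpow_of_lt (by linarith) ha),
    integral_Ioi_rpow_of_lt (by linarith) ha]
  · congr 1
    rw [sub_add_cancel, neg_div_neg_eq]
  · filter_upwards [ae_restrict_mem measurableSet_Ioi] with t ht
    exact Real.rpow_nonneg (ha.trans ht).le _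

/-- If `A_α(f)` vanishes on the part of the cone below height `a` and is at most `c t^{-β}` above
it, then `S_α(f)(x)` is at most a constant times `c a^{-β}`. -/
theorem S_le_of_A_le {f : Rn n → 𝕜} {x : Rn n} {a β : ℝ} (ha : 0 < a) (hβ : 0 < β) {c : ℝ≥0∞}
    (h0 : ∀ y t, 0 < t → ‖x - y‖ < t → t ≤ a → A α f y t = 0)
    (h1 : ∀ y t, a < t → ‖x - y‖ < t → A α f y t ≤ c * ENNReal.ofReal (t ^ (-β))) :
    S α f x ≤ (volume (ball (0 : Rn n) 1) * ENNReal.ofReal (2 * β)⁻¹) ^ (1 / 2 : ℝ) *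
      (c * ENNReal.ofReal (a ^ (-β))) := by
  have hS : S α f x ^ 2 ≤ c ^ 2 * (volume (ball (0 : Rn n) 1) *
      ENNReal.ofReal (a ^ (-(2 * β)) / (2 * β))) := by
    set H : ℝ → ℝ≥0∞ := fun t => (Set.Ioi a).indicator
      (fun t => ENNReal.ofReal (t ^ (-(2 * β))) / ENNReal.ofReal (t ^ (n + 1))) t with hH
    have hHm : Measurable H := Measurable.indicator (by fun_prop) measurableSet_Ioi
    calc S α f x ^ 2 = ∫⁻ q in cone x, A α f q.1 q.2 ^ 2 / ENNReal.ofReal (q.2 ^ (n + 1)) := by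
          rw [S, ← ENNReal.rpow_natCast, ← ENNReal.rpow_mul]
          norm_num
      _ ≤ ∫⁻ q in cone x, c ^ 2 * H q.2 := by
          refine setLIntegral_mono' (measurableSet_cone x) fun q hq => ?_
          by_cases hqa : a < q.2
          · have hq0 := hq.1
            simp only [hH, Set.indicator_of_mem (Set.mem_Ioi.2 hqa)]
            rw [← mul_div_assoc]
            gcongr
            refine (pow_le_pow_left' (h1 _ _ hqa hq.2) 2).trans_eq ?_
            rw [mul_pow, ← ENNReal.ofReal_pow (by positivity), ← Real.rpow_mul_natCast hq0.le]
            congr 3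
            push_cast
            ring
          · rw [h0 _ _ hq.1 hq.2 (not_lt.1 hqa)]
            simp
      _ = ∫⁻ q, (cone x).indicator (fun q => c ^ 2 * H q.2) q := by
          rw [lintegral_indicator (measurableSet_cone x)]
      _ = ∫⁻ t, ∫⁻ y, (cone x).indicator (fun q : Rn n × ℝ => c ^ 2 * H q.2) (y, t) := by
          rw [Measure.volume_eq_prod, lintegral_prod_symm']
          exact Measurable.indicator (by fun_prop) (measurableSet_cone x)
      _ = ∫⁻ t in Set.Ioi a, c ^ 2 * (volume (ball (0 : Rn n) 1) *
            ENNReal.ofReal (t ^ (-(2 * β) - 1))) := by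
          rw [← lintegral_indicator measurableSet_Ioi]
          refine lintegral_congr fun t => ?_
          by_cases hta : a < t
          · have ht : 0 < t := ha.trans hta
            have h2 (y : Rn n) : (cone x).indicator (fun q : Rn n × ℝ => c ^ 2 * H q.2) (y, t)
                = (ball x t).indicator (fun _ => c ^ 2 * H t) y := by
              by_cases hy : y ∈ ball x t
              · rw [Set.indicator_of_mem hy, Set.indicator_of_mem]
                exact ⟨ht, by rwa [mem_ball_iff_norm'] at hy⟩
              · rw [Set.indicator_of_notMem hy, Set.indicator_of_notMem]
                exact fun h => hy (by rw [mem_ball_iff_norm']; exact h.2)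
            simp_rw [h2]
            rw [lintegral_indicator_const measurableSet_ball, volume_ball_eq _ ht,
              Set.indicator_of_mem (Set.mem_Ioi.2 hta)]
            simp only [hH, Set.indicator_of_mem (Set.mem_Ioi.2 hta)]
            have h3 : ENNReal.ofReal (t ^ (-(2 * β))) / ENNReal.ofReal (t ^ (n + 1)) *
                ENNReal.ofReal (t ^ n) = ENNReal.ofReal (t ^ (-(2 * β) - 1)) := by
              rw [← ENNReal.ofReal_div_of_pos (by positivity),
                ← ENNReal.ofReal_mul (by positivity), Real.rpow_sub_one ht.ne']
              congr 1
              field_simp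
              ring
            rw [← h3]
            ring
          · have h2 (y : Rn n) :
                (cone x).indicator (fun q : Rn n × ℝ => c ^ 2 * H q.2) (y, t) = 0 := by
              have : H t = 0 := Set.indicator_of_notMem (by simpa using hta) _
              by_cases h : (y, t) ∈ cone x
              · rw [Set.indicator_of_mem h]; simp [this]
              · exact Set.indicator_of_notMem h _
            simp [h2, hta]
      _ = c ^ 2 * (volume (ball (0 : Rn n) 1) *
            ENNReal.ofReal (a ^ (-(2 * β)) / (2 * β))) := by
          rw [lintegral_const_mul _ (by fun_prop), lintegral_const_mul _ (by fun_prop),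
            lintegral_Ioi_rpow ha (by positivity)]
  have h4 : c ^ 2 * (volume (ball (0 : Rn n) 1) * ENNReal.ofReal (a ^ (-(2 * β)) / (2 * β)))
      = ((volume (ball (0 : Rn n) 1) * ENNReal.ofReal (2 * β)⁻¹) ^ (1 / 2 : ℝ) *
      (c * ENNReal.ofReal (a ^ (-β)))) ^ 2 := by
    have h5 : a ^ (-(2 * β)) = (a ^ (-β)) ^ 2 := by
      rw [← Real.rpow_mul_natCast ha.le]
      congr 1
      push_cast
      ring
    rw [mul_pow, mul_pow, ← ENNReal.rpow_natCast (_ ^ (1 / 2 : ℝ)), ← ENNReal.rpow_mul, h5,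
      div_eq_mul_inv, ENNReal.ofReal_mul (by positivity), ENNReal.ofReal_pow (by positivity)]
    norm_num
    ring
  rw [h4] at hS
  exact (ENNReal.pow_le_pow_left_iff (by norm_num)).1 hS

/-! ### The `T T*` method with Schur's test -/

/-- The Cauchy–Schwarz inequality for nonnegative functions, in squared form. -/
theorem lintegral_mul_sq_le {X : Type*} [MeasurableSpace X] {μ : Measure X} {f g : X → ℝ≥0∞}
    (hf : AEMeasurable f μ) (hg : AEMeasurable g μ) :
    (∫⁻ x, f x * g x ∂μ) ^ 2 ≤ (∫⁻ x, f x ^ 2 ∂μ) * ∫⁻ x, g x ^ 2 ∂μ := by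
  have h := ENNReal.lintegral_mul_le_Lp_mul_Lq μ (p := 2) (q := 2)
    (by constructor <;> norm_num) hf hg
  calc (∫⁻ x, f x * g x ∂μ) ^ 2 ≤ ((∫⁻ x, f x ^ (2 : ℝ) ∂μ) ^ (1 / 2 : ℝ) *
        (∫⁻ x, g x ^ (2 : ℝ) ∂μ) ^ (1 / 2 : ℝ)) ^ 2 := pow_le_pow_left' h 2
    _ = _ := by
      rw [mul_pow, ← ENNReal.rpow_natCast, ← ENNReal.rpow_natCast, ← ENNReal.rpow_mul,
        ← ENNReal.rpow_mul]
      norm_num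

theorem lintegral_enorm_sq_eq {Y : Type*} [MeasurableSpace Y] {m : Measure Y} {w : Y → ℝ}
    (hw : Measurable w) (hwt : ∫⁻ y, ‖w y‖ₑ ^ 2 ∂m ≠ ∞) :
    ∫⁻ y, ‖w y‖ₑ ^ 2 ∂m = ‖∫ y, w y * w y ∂m‖ₑ := by
  have h1 (y : Y) : ‖w y‖ₑ ^ 2 = ENNReal.ofReal (w y * w y) := by
    rw [Real.enorm_eq_ofReal_abs, ← ENNReal.ofReal_pow (abs_nonneg _), sq_abs, sq]
  have h2 : 0 ≤ ∫ y, w y * w y ∂m := integral_nonneg fun y => mul_self_nonneg _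
  rw [Real.enorm_of_nonneg h2, ofReal_integral_eq_lintegral_ofReal _
    (ae_of_all _ fun y => mul_self_nonneg (w y))]
  · simp_rw [h1]
  · refine ⟨(hw.mul hw).aestronglyMeasurable, ?_⟩
    rw [HasFiniteIntegral]
    simp_rw [enorm_mul, ← sq]
    exact hwt.lt_top

section Schur

variable {X Z : Type*} [MeasurableSpace X] [MeasurableSpace Z] {μ : Measure X} {ν : Measure Z}
  {k : X → Z → ℝ} {M : ℝ≥0∞}

theorem enorm_integral_mul_sq_le (hk : Measurable (Function.uncurry k))
    (hM : ∀ q, ∫⁻ z, ‖k q z‖ₑ ^ 2 ∂ν ≤ M) {φ : Z → ℝ} (hφ : Measurable φ) (q : X) :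
    (∫⁻ z, ‖k q z * φ z‖ₑ ∂ν) ^ 2 ≤ M * ∫⁻ z, ‖φ z‖ₑ ^ 2 ∂ν := by
  simp_rw [enorm_mul]
  exact (lintegral_mul_sq_le (hk.of_uncurry_left.enorm.aemeasurable) hφ.enorm.aemeasurable).trans
    (mul_le_mul_left (hM q) _)

variable [IsFiniteMeasure μ] [SFinite ν]

/-- The operator with kernel `k` and its transpose are dual to each other. -/
theorem integral_integral_kernel_swap (hk : Measurable (Function.uncurry k)) (hM' : M ≠ ∞)
    (hM : ∀ q, ∫⁻ z, ‖k q z‖ₑ ^ 2 ∂ν ≤ M) {φ : Z → ℝ} (hφ : Measurable φ)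
    (hφ2 : ∫⁻ z, ‖φ z‖ₑ ^ 2 ∂ν ≠ ∞) {g : X → ℝ} (hg : Measurable g)
    (hg2 : ∫⁻ q, ‖g q‖ₑ ^ 2 ∂μ ≠ ∞) :
    ∫ q, (∫ z, k q z * φ z ∂ν) * g q ∂μ = ∫ z, φ z * (∫ q, k q z * g q ∂μ) ∂ν := by
  have hint : Integrable (Function.uncurry fun q z => k q z * φ z * g q) (μ.prod ν) := by
    refine ⟨((hk.mul (hφ.comp measurable_snd)).mul (hg.comp measurable_fst)).aestronglyMeasurable,
      ?_⟩
    rw [HasFiniteIntegral, lintegral_prod]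
    swap
    · exact ((hk.mul (hφ.comp measurable_snd)).mul (hg.comp measurable_fst)).enorm.aemeasurable
    set B := (M * ∫⁻ z, ‖φ z‖ₑ ^ 2 ∂ν) with hB
    have hBt : B ≠ ∞ := ENNReal.mul_ne_top hM' hφ2
    calc ∫⁻ q, ∫⁻ z, ‖k q z * φ z * g q‖ₑ ∂ν ∂μ
        = ∫⁻ q, (∫⁻ z, ‖k q z * φ z‖ₑ ∂ν) * ‖g q‖ₑ ∂μ := by
          refine lintegral_congr fun q => ?_
          rw [← lintegral_mul_const' _ _ enorm_ne_top]
          simp only [enorm_mul]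
      _ ≤ ∫⁻ q, B + ‖g q‖ₑ ^ 2 ∂μ := by
          refine lintegral_mono fun q => ?_
          have h1 := enorm_integral_mul_sq_le hk hM hφ q
          refine le_trans ?_ (add_le_add h1 le_rfl)
          rcases le_total (∫⁻ z, ‖k q z * φ z‖ₑ ∂ν) ‖g q‖ₑ with h | h
          · refine le_trans ?_ le_add_self
            rw [sq]; gcongr
          · refine le_trans ?_ le_self_add
            rw [sq]; gcongr
      _ < ∞ := by
          rw [lintegral_add_left measurable_const, lintegral_const]
          exact ENNReal.add_lt_top.2
            ⟨ENNReal.mul_lt_top hBt.lt_top (measure_lt_top _ _), hg2.lt_top⟩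
  calc ∫ q, (∫ z, k q z * φ z ∂ν) * g q ∂μ = ∫ q, ∫ z, k q z * φ z * g q ∂ν ∂μ := by
        simp_rw [integral_mul_const]
    _ = ∫ z, ∫ q, k q z * φ z * g q ∂μ ∂ν := integral_integral_swap hint
    _ = _ := by
        refine integral_congr_ae (ae_of_all _ fun z => ?_)
        simp only
        rw [← integral_const_mul]
        refine integral_congr_ae (ae_of_all _ fun q => ?_)
        simp only
        ring

/-- The `T T*` method combined with Schur's test: if the kernel `∫ k(q,z) k(q',z) dz` of `T T*` has
row integrals at most `C`, then the integral operator `T` with kernel `k` satisfies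
`‖T f‖₂² ≤ C ‖f‖₂²`. -/
theorem lintegral_integral_sq_le_of_schur (hk : Measurable (Function.uncurry k)) (hM' : M ≠ ∞)
    (hM : ∀ q, ∫⁻ z, ‖k q z‖ₑ ^ 2 ∂ν ≤ M) {C : ℝ≥0∞}
    (hC : ∀ q, ∫⁻ q', ‖∫ z, k q z * k q' z ∂ν‖ₑ ∂μ ≤ C) {f : Z → ℝ} (hf : Measurable f)
    (hf2 : ∫⁻ z, ‖f z‖ₑ ^ 2 ∂ν ≠ ∞) :
    ∫⁻ q, ‖∫ z, k q z * f z ∂ν‖ₑ ^ 2 ∂μ ≤ C * ∫⁻ z, ‖f z‖ₑ ^ 2 ∂ν := by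
  set g : X → ℝ := fun q => ∫ z, k q z * f z ∂ν with hg_def
  have hg : Measurable g :=
    (hk.mul (hf.comp measurable_snd)).stronglyMeasurable.integral_prod_right.measurable
  set F := ∫⁻ z, ‖f z‖ₑ ^ 2 ∂ν with hF
  set I := ∫⁻ q, ‖g q‖ₑ ^ 2 ∂μ with hI
  have hIt : I ≠ ∞ := by
    have : I ≤ ∫⁻ q, M * F ∂μ := lintegral_mono fun q =>
      (pow_le_pow_left' (enorm_integral_le_lintegral_enorm _) 2).trans
        (enorm_integral_mul_sq_le hk hM hf q)
    refine ne_top_of_le_ne_top ?_ this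
    rw [lintegral_const]
    exact ENNReal.mul_ne_top (ENNReal.mul_ne_top hM' hf2) (measure_ne_top _ _)
  set h : Z → ℝ := fun z => ∫ q, k q z * g q ∂μ with hh_def
  have hh : Measurable h :=
    (hk.mul (hg.comp measurable_fst)).stronglyMeasurable.integral_prod_left.measurable
  set H := ∫⁻ z, ‖h z‖ₑ ^ 2 ∂ν with hH
  have hHt : H ≠ ∞ := by
    have h1 : H ≤ ∫⁻ z, (∫⁻ q, ‖k q z‖ₑ ^ 2 ∂μ) * I ∂ν := by
      refine lintegral_mono fun z =>
        (pow_le_pow_left' (enorm_integral_le_lintegral_enorm _) 2).trans ?_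
      simp_rw [enorm_mul]
      exact lintegral_mul_sq_le hk.of_uncurry_right.enorm.aemeasurable hg.enorm.aemeasurable
    refine ne_top_of_le_ne_top ?_ h1
    rw [lintegral_mul_const' _ _ hIt, lintegral_lintegral_swap]
    · refine ENNReal.mul_ne_top (ne_top_of_le_ne_top ?_ (lintegral_mono hM)) hIt
      rw [lintegral_const]
      exact ENNReal.mul_ne_top hM' (measure_ne_top _ _)
    · exact ((hk.comp measurable_swap).enorm.pow_const 2).aemeasurable
  -- `‖T f‖² = ⟨f, T* T f⟩ ≤ ‖f‖ ‖h‖`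
  have hIH : I ^ 2 ≤ F * H := by
    have : I = ‖∫ z, f z * h z ∂ν‖ₑ := by
      rw [hI, lintegral_enorm_sq_eq hg hIt, ← integral_integral_kernel_swap hk hM' hM hf hf2 hg hIt]
    rw [this]
    refine (pow_le_pow_left' (enorm_integral_le_lintegral_enorm _) 2).trans ?_
    simp_rw [enorm_mul]
    exact lintegral_mul_sq_le hf.enorm.aemeasurable hh.enorm.aemeasurable
  have hKm : Measurable (Function.uncurry fun q q' => ∫ z, k q z * k q' z ∂ν) := by
    refine (StronglyMeasurable.integral_prod_right'
      (f := fun p : (X × X) × Z => k p.1.1 p.2 * k p.1.2 p.2) ?_).measurable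
    exact ((hk.comp (measurable_fst.fst.prodMk measurable_snd)).mul
      (hk.comp (measurable_fst.snd.prodMk measurable_snd))).stronglyMeasurable
  -- `‖h‖² = ⟨T T* g, g⟩`, estimated by Schur's test
  have hHI : H ≤ C * I := by
    have h1 : H = ‖∫ q, (∫ q', (∫ z, k q z * k q' z ∂ν) * g q' ∂μ) * g q ∂μ‖ₑ := by
      rw [hH, lintegral_enorm_sq_eq hh hHt, ← integral_integral_kernel_swap hk hM' hM hh hHt hg hIt]
      congr 2
      funext q
      congr 1
      rw [← integral_integral_kernel_swap hk hM' hM hk.of_uncurry_left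
        (ne_top_of_le_ne_top hM' (hM q)) hg hIt]
      congr 1
      funext q'
      congr 2
      funext z
      ring
    have hsymm (q q' : X) : ‖∫ z, k q z * k q' z ∂ν‖ₑ = ‖∫ z, k q' z * k q z ∂ν‖ₑ := by
      simp_rw [mul_comm]
    have hmeas1 : Measurable (Function.uncurry fun q q' =>
        ‖∫ z, k q z * k q' z ∂ν‖ₑ * ‖g q‖ₑ ^ 2) :=
      hKm.enorm.mul ((hg.comp measurable_fst).enorm.pow_const 2)
    have hrow : ∫⁻ q, ∫⁻ q', ‖∫ z, k q z * k q' z ∂ν‖ₑ * ‖g q‖ₑ ^ 2 ∂μ ∂μ ≤ C * I := by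
      rw [hI, ← lintegral_const_mul _ (hg.enorm.pow_const 2)]
      refine lintegral_mono fun q => ?_
      rw [lintegral_mul_const' _ _ (by finiteness)]
      gcongr
      exact hC q
    have hcol : ∫⁻ q, ∫⁻ q', ‖∫ z, k q z * k q' z ∂ν‖ₑ * ‖g q'‖ₑ ^ 2 ∂μ ∂μ ≤ C * I := by
      rw [lintegral_lintegral_swap]
      · refine le_trans (le_of_eq ?_) hrow
        refine lintegral_congr fun q' => lintegral_congr fun q => ?_
        rw [hsymm]
      · exact (hKm.enorm.mul ((hg.comp measurable_snd).enorm.pow_const 2)).aemeasurable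
    have h2 : H + H ≤ C * I + C * I := by
      refine le_trans ?_ (add_le_add hrow hcol)
      rw [← lintegral_add_left hmeas1.lintegral_prod_right, ← two_mul]
      have hle : H ≤ ∫⁻ q, ∫⁻ q', ‖∫ z, k q z * k q' z ∂ν‖ₑ * (‖g q‖ₑ * ‖g q'‖ₑ) ∂μ ∂μ := by
        rw [h1]
        refine (enorm_integral_le_lintegral_enorm _).trans (lintegral_mono fun q => ?_)
        rw [enorm_mul]
        refine (mul_le_mul_left (enorm_integral_le_lintegral_enorm _) _).trans_eq ?_
        rw [← lintegral_mul_const' _ _ enorm_ne_top]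
        refine lintegral_congr fun q' => ?_
        rw [enorm_mul]
        ring
      refine (mul_le_mul_right hle 2).trans ?_
      rw [← lintegral_const_mul' _ _ (by norm_num)]
      refine lintegral_mono fun q => ?_
      rw [← lintegral_const_mul' _ _ (by norm_num),
        ← lintegral_add_left hmeas1.of_uncurry_left]
      refine lintegral_mono fun q' => ?_
      have h3 : 2 * (‖g q‖ₑ * ‖g q'‖ₑ) ≤ ‖g q‖ₑ ^ 2 + ‖g q'‖ₑ ^ 2 := by
        simp only [Real.enorm_eq_ofReal_abs]
        rw [← ENNReal.ofReal_mul (abs_nonneg _), ← ENNReal.ofReal_pow (abs_nonneg _),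
          ← ENNReal.ofReal_pow (abs_nonneg _), ← ENNReal.ofReal_add (by positivity) (by positivity),
          show (2 : ℝ≥0∞) = ENNReal.ofReal 2 by simp, ← ENNReal.ofReal_mul (by norm_num)]
        refine ENNReal.ofReal_le_ofReal ?_
        nlinarith [two_mul_le_add_sq |g q| |g q'|]
      calc 2 * (‖∫ z, k q z * k q' z ∂ν‖ₑ * (‖g q‖ₑ * ‖g q'‖ₑ))
          = ‖∫ z, k q z * k q' z ∂ν‖ₑ * (2 * (‖g q‖ₑ * ‖g q'‖ₑ)) := by ring
        _ ≤ ‖∫ z, k q z * k q' z ∂ν‖ₑ * (‖g q‖ₑ ^ 2 + ‖g q'‖ₑ ^ 2) := by gcongr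
        _ = _ := by ring
    rw [← two_mul, ← two_mul] at h2
    exact (ENNReal.mul_le_mul_iff_right (by norm_num) (by norm_num)).1 h2
  by_cases hI0 : I = 0
  · rw [hI0]; exact bot_le
  · have : I * I ≤ I * (C * F) := by
      rw [← sq]
      refine hIH.trans ((mul_le_mul_right hHI F).trans_eq ?_)
      ring
    exact (ENNReal.mul_le_mul_iff_right hI0 hIt).1 this

end Schur

/-! ### The `L²` bound -/

theorem lintegral_enorm_dilate_le [NeZero n] (hα₀ : 0 < α) (hα₁ : α ≤ 1) {φ : Rn n → ℝ}
    (hφ : φ ∈ testFamily n α) {t : ℝ} (ht : 0 < t) (y : Rn n) :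
    ∫⁻ z, ‖dilate φ t (y - z)‖ₑ ≤ 3 * volume (ball (0 : Rn n) 1) := by
  calc ∫⁻ z, ‖dilate φ t (y - z)‖ₑ
      ≤ ∫⁻ z, (closedBall y t).indicator (fun _ => ENNReal.ofReal (3 * (t ^ n)⁻¹)) z := by
        refine lintegral_mono fun z => ?_
        by_cases hz : z ∈ closedBall y t
        · rw [Set.indicator_of_mem hz, Real.enorm_eq_ofReal_abs]
          exact ENNReal.ofReal_le_ofReal (abs_dilate_le hα₀ hα₁ hφ ht _)
        · rw [mem_closedBall, dist_comm, dist_eq_norm, not_le] at hz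
          simp [dilate_eq_zero hφ ht hz]
    _ = 3 * volume (ball (0 : Rn n) 1) := by
        rw [lintegral_indicator_const measurableSet_closedBall, volume_closedBall_eq _ ht,
          ← mul_assoc, ← ENNReal.ofReal_mul (by positivity), mul_assoc,
          inv_mul_cancel₀ (by positivity)]
        simp

theorem lintegral_enorm_sq_dilate_le [NeZero n] (hα₀ : 0 < α) (hα₁ : α ≤ 1) {φ : Rn n → ℝ}
    (hφ : φ ∈ testFamily n α) {t : ℝ} (ht : 0 < t) (y : Rn n) :
    ∫⁻ z, ‖dilate φ t (y - z)‖ₑ ^ 2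
      ≤ ENNReal.ofReal (3 * (t ^ n)⁻¹) * (3 * volume (ball (0 : Rn n) 1)) := by
  refine le_trans ?_ (mul_le_mul_right (lintegral_enorm_dilate_le hα₀ hα₁ hφ ht y) _)
  rw [← lintegral_const_mul' _ _ ENNReal.ofReal_ne_top]
  refine lintegral_mono fun z => ?_
  rw [sq]
  gcongr
  rw [Real.enorm_eq_ofReal_abs]
  exact ENNReal.ofReal_le_ofReal (abs_dilate_le hα₀ hα₁ hφ ht _)

/-- Almost orthogonality of two dilates, where `t ≤ t'`: the one at the smaller scale has mean zero,
the one at the larger scale is Hölder continuous. -/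
theorem enorm_integral_dilate_mul_le_of_le [NeZero n] (hα₀ : 0 < α) (hα₁ : α ≤ 1)
    {φ ψ : Rn n → ℝ} (hφ : φ ∈ testFamily n α) (hψ : ψ ∈ testFamily n α) {t t' : ℝ} (ht : 0 < t)
    (htt' : t ≤ t') (y y' : Rn n) :
    ‖∫ z, dilate φ t (y - z) * dilate ψ t' (y' - z)‖ₑ
      ≤ ENNReal.ofReal ((t' ^ n)⁻¹ * (t / t') ^ α) * (3 * volume (ball (0 : Rn n) 1)) := by
  have hb : Integrable fun z => dilate φ t (y - z) :=
    Continuous.integrable_of_hasCompactSupport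
      ((continuous_dilate hα₀ hφ t).comp (continuous_const.sub continuous_id))
      (hasCompactSupport_dilate hφ ht y)
  have h1 := A_le_of_integral_eq_zero hα₀ hb (integral_dilate hφ t y) (c := y) (ρ := t)
    (fun z hz => dilate_eq_zero hφ ht (by
      rwa [mem_closedBall, dist_comm, dist_eq_norm, not_le] at hz)) y' (ht.trans_le htt')
  refine le_trans ?_ (h1.trans (mul_le_mul_right (lintegral_enorm_dilate_le hα₀ hα₁ hφ ht y) _))
  refine le_trans (le_of_eq ?_) (enorm_le_A hψ y' t')
  simp only [smul_eq_mul, mul_comm]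

theorem integral_dilate_mul_eq_zero {φ ψ : Rn n → ℝ} (hφ : φ ∈ testFamily n α)
    (hψ : ψ ∈ testFamily n α) {t t' : ℝ} (ht : 0 < t) (ht' : 0 < t') {y y' : Rn n}
    (h : t + t' < dist y' y) : ∫ z, dilate φ t (y - z) * dilate ψ t' (y' - z) = 0 := by
  have (z : Rn n) : dilate φ t (y - z) * dilate ψ t' (y' - z) = 0 := by
    by_cases h1 : t < ‖y - z‖
    · rw [dilate_eq_zero hφ ht h1, zero_mul]
    · rw [dilate_eq_zero hψ ht', mul_zero]
      have := dist_triangle y' z y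
      rw [dist_eq_norm y' z, dist_comm z y, dist_eq_norm y z] at this
      linarith
  simp [this]

/-- Both orders of the scales in one bound. -/
theorem enorm_integral_dilate_mul_le [NeZero n] (hα₀ : 0 < α) (hα₁ : α ≤ 1)
    {φ ψ : Rn n → ℝ} (hφ : φ ∈ testFamily n α) (hψ : ψ ∈ testFamily n α) {t t' : ℝ} (ht : 0 < t)
    (ht' : 0 < t') (y y' : Rn n) :
    ‖∫ z, dilate φ t (y - z) * dilate ψ t' (y' - z)‖ₑ
      ≤ (closedBall y (2 * max t t')).indicator (fun _ => 3 * volume (ball (0 : Rn n) 1) *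
        ENNReal.ofReal ((max t t' ^ n)⁻¹ * (min t t' / max t t') ^ α)) y' := by
  by_cases hy : y' ∈ closedBall y (2 * max t t')
  · rw [Set.indicator_of_mem hy, mul_comm]
    rcases le_total t t' with h | h
    · rw [max_eq_right h, min_eq_left h]
      exact enorm_integral_dilate_mul_le_of_le hα₀ hα₁ hφ hψ ht h y y'
    · rw [max_eq_left h, min_eq_right h]
      refine le_trans (le_of_eq ?_)
        (enorm_integral_dilate_mul_le_of_le hα₀ hα₁ hψ hφ ht' h y' y)
      simp only [mul_comm]
  · rw [Set.indicator_of_notMem hy, integral_dilate_mul_eq_zero hφ hψ ht ht']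
    · simp
    · rw [mem_closedBall, not_le] at hy
      linarith [le_max_left t t', le_max_right t t']

theorem lintegral_Ioc_rpow {a s : ℝ} (ha : 0 < a) (hs : 0 < s) :
    ∫⁻ t in Set.Ioc 0 a, ENNReal.ofReal (t ^ (s - 1)) = ENNReal.ofReal (a ^ s / s) := by
  have hint : IntervalIntegrable (fun t : ℝ => t ^ (s - 1)) volume 0 a :=
    intervalIntegral.intervalIntegrable_rpow' (by linarith)
  rw [← ofReal_integral_eq_lintegral_ofReal
      ((intervalIntegrable_iff_integrableOn_Ioc_of_le ha.le).1 hint),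
    ← intervalIntegral.integral_of_le ha.le, integral_rpow (Or.inl (by linarith))]
  · simp [hs.ne']
  · filter_upwards [ae_restrict_mem measurableSet_Ioc] with t ht
    exact Real.rpow_nonneg ht.1.le _

theorem lintegral_Ioi_min_div_max_rpow (hα₀ : 0 < α) {t : ℝ} (ht : 0 < t) :
    ∫⁻ t' in Set.Ioi 0, ENNReal.ofReal ((min t t' / max t t') ^ α) * ENNReal.ofReal t'⁻¹
      = ENNReal.ofReal (2 / α) := by
  rw [← Set.Ioc_union_Ioi_eq_Ioi ht.le, lintegral_union measurableSet_Ioi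
    (Set.Ioc_disjoint_Ioi le_rfl)]
  have h1 : ∫⁻ t' in Set.Ioc 0 t, ENNReal.ofReal ((min t t' / max t t') ^ α) * ENNReal.ofReal t'⁻¹
      = ENNReal.ofReal (1 / α) := by
    have : ∫⁻ t' in Set.Ioc 0 t, ENNReal.ofReal ((min t t' / max t t') ^ α) * ENNReal.ofReal t'⁻¹
        = ∫⁻ t' in Set.Ioc 0 t, ENNReal.ofReal (t ^ (-α)) * ENNReal.ofReal (t' ^ (α - 1)) := by
      refine setLIntegral_congr_fun measurableSet_Ioc fun t' ht' => ?_
      have h0 : 0 < t' := ht'.1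
      rw [← ENNReal.ofReal_mul (by positivity), ← ENNReal.ofReal_mul (by positivity),
        min_eq_right ht'.2, max_eq_left ht'.2, Real.div_rpow h0.le ht.le, Real.rpow_neg ht.le,
        Real.rpow_sub_one h0.ne']
      congr 1
      ring
    rw [this, lintegral_const_mul _ (by fun_prop), lintegral_Ioc_rpow ht hα₀,
      ← ENNReal.ofReal_mul (by positivity), Real.rpow_neg ht.le]
    congr 1
    have := (Real.rpow_pos_of_pos ht α).ne'
    field_simp
  have h2 : ∫⁻ t' in Set.Ioi t, ENNReal.ofReal ((min t t' / max t t') ^ α) * ENNReal.ofReal t'⁻¹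
      = ENNReal.ofReal (1 / α) := by
    have : ∫⁻ t' in Set.Ioi t, ENNReal.ofReal ((min t t' / max t t') ^ α) * ENNReal.ofReal t'⁻¹
        = ∫⁻ t' in Set.Ioi t, ENNReal.ofReal (t ^ α) * ENNReal.ofReal (t' ^ (-α - 1)) := by
      refine setLIntegral_congr_fun measurableSet_Ioi fun t' ht' => ?_
      have h0 : 0 < t' := ht.trans ht'
      have h3 : t ≤ t' := le_of_lt ht'
      rw [← ENNReal.ofReal_mul (by positivity), ← ENNReal.ofReal_mul (by positivity),
        min_eq_left h3, max_eq_right h3, Real.div_rpow ht.le h0.le, Real.rpow_sub_one h0.ne',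
        Real.rpow_neg h0.le]
      congr 1
      ring
    rw [this, lintegral_const_mul _ (by fun_prop), lintegral_Ioi_rpow ht hα₀,
      ← ENNReal.ofReal_mul (by positivity), Real.rpow_neg ht.le]
    congr 1
    have := (Real.rpow_pos_of_pos ht α).ne'
    field_simp
  rw [h1, h2, ← ENNReal.ofReal_add (by positivity) (by positivity)]
  congr 1
  ring

/-- Schur's test for the kernel of `T T*`, for an arbitrary choice of a test function `ψ q'` at each
point of the upper half space. -/
theorem lintegral_enorm_integral_dilate_mul_le [NeZero n] (hα₀ : 0 < α) (hα₁ : α ≤ 1)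
    {φ : Rn n → ℝ} {ψ : Rn n × ℝ → Rn n → ℝ} (hφ : φ ∈ testFamily n α)
    (hψ : ∀ q, ψ q ∈ testFamily n α) {t : ℝ} (ht : 0 < t) (y : Rn n) :
    ∫⁻ q in {q : Rn n × ℝ | 0 < q.2},
      ‖∫ z, dilate φ t (y - z) * dilate (ψ q) q.2 (q.1 - z)‖ₑ * ENNReal.ofReal q.2⁻¹
      ≤ 3 * volume (ball (0 : Rn n) 1) ^ 2 * ENNReal.ofReal (2 ^ n) * ENNReal.ofReal (2 / α) := by
  have hpos : MeasurableSet {q : Rn n × ℝ | 0 < q.2} :=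
    measurableSet_lt measurable_const measurable_snd
  set v := volume (ball (0 : Rn n) 1) with hv
  set w : ℝ → ℝ≥0∞ := fun t' => 3 * v *
        ENNReal.ofReal ((max t t' ^ n)⁻¹ * (min t t' / max t t') ^ α) * ENNReal.ofReal t'⁻¹ with hw
  set G : Rn n × ℝ → ℝ≥0∞ := {q : Rn n × ℝ | 0 < q.2 ∧ dist q.1 y ≤ 2 * max t q.2}.indicator
    fun q => w q.2 with hG
  have hset : MeasurableSet {q : Rn n × ℝ | 0 < q.2 ∧ dist q.1 y ≤ 2 * max t q.2} :=
    by
    have h1 : Measurable fun q : Rn n × ℝ => dist q.1 y := by fun_prop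
    have h2 : Measurable fun q : Rn n × ℝ => 2 * max t q.2 := by fun_prop
    exact hpos.inter (measurableSet_le h1 h2)
  have hwm : Measurable w := by fun_prop
  have hGm : Measurable G := (hwm.comp measurable_snd).indicator hset
  calc _ ≤ ∫⁻ q in {q : Rn n × ℝ | 0 < q.2}, G q := by
        refine setLIntegral_mono' hpos fun q hq => ?_
        have h1 := enorm_integral_dilate_mul_le hα₀ hα₁ hφ (hψ q) ht hq y q.1
        by_cases hy : q.1 ∈ closedBall y (2 * max t q.2)
        · rw [Set.indicator_of_mem hy] at h1
          rw [hG, Set.indicator_of_mem (by exact ⟨hq, hy⟩)]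
          exact mul_le_mul_left h1 _
        · rw [Set.indicator_of_notMem hy] at h1
          rw [le_bot_iff.1 h1]
          simp
    _ ≤ ∫⁻ q, G q := setLIntegral_le_lintegral _ _
    _ = ∫⁻ t', ∫⁻ y', G (y', t') := by
        rw [Measure.volume_eq_prod, lintegral_prod_symm' _ hGm]
    _ = ∫⁻ t' in Set.Ioi 0, 3 * v ^ 2 * ENNReal.ofReal (2 ^ n) *
          (ENNReal.ofReal ((min t t' / max t t') ^ α) * ENNReal.ofReal t'⁻¹) := by
        rw [← lintegral_indicator measurableSet_Ioi]
        refine lintegral_congr fun t' => ?_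
        by_cases ht' : 0 < t'
        · have hm : 0 < max t t' := lt_max_of_lt_left ht
          have h2 (y' : Rn n) : G (y', t') =
              (closedBall y (2 * max t t')).indicator (fun _ => w t') y' := by
            by_cases hy : y' ∈ closedBall y (2 * max t t')
            · rw [Set.indicator_of_mem hy, hG, Set.indicator_of_mem (by exact ⟨ht', hy⟩)]
            · rw [Set.indicator_of_notMem hy, hG,
                Set.indicator_of_notMem (by exact fun h => hy h.2)]
          simp_rw [h2]
          rw [lintegral_indicator_const measurableSet_closedBall,
            volume_closedBall_eq _ (by positivity), Set.indicator_of_mem (Set.mem_Ioi.2 ht'),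
            ← hv, mul_pow, ENNReal.ofReal_mul (by positivity)]
          simp only [hw]
          rw [ENNReal.ofReal_mul (p := (max t t' ^ n)⁻¹) (by positivity)]
          have h3 : ENNReal.ofReal (max t t' ^ n)⁻¹ * ENNReal.ofReal (max t t' ^ n) = 1 := by
            rw [← ENNReal.ofReal_mul (by positivity), inv_mul_cancel₀ (by positivity)]
            simp
          calc _ = (ENNReal.ofReal (max t t' ^ n)⁻¹ * ENNReal.ofReal (max t t' ^ n)) *
                (3 * v ^ 2 * ENNReal.ofReal (2 ^ n) *
                (ENNReal.ofReal ((min t t' / max t t') ^ α) * ENNReal.ofReal t'⁻¹)) := by ring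
            _ = _ := by rw [h3, one_mul]
        · have h2 (y' : Rn n) : G (y', t') = 0 := Set.indicator_of_notMem (fun h => ht' h.1) _
          simp [h2, ht']
    _ = _ := by
        rw [lintegral_const_mul _ (by fun_prop), lintegral_Ioi_min_div_max_rpow hα₀ ht]

/-- The constant in the `L²` bound for `A_α`. -/
noncomputable def l2Const (n : ℕ) (α : ℝ) : ℝ≥0∞ :=
  3 * volume (ball (0 : Rn n) 1) ^ 2 * ENNReal.ofReal (2 ^ n) * ENNReal.ofReal (2 / α)

theorem l2Const_ne_top : l2Const n α ≠ ∞ := by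
  have : volume (ball (0 : Rn n) 1) ≠ ∞ := measure_ball_lt_top.ne
  unfold l2Const
  finiteness

theorem measurableSet_box (R : ℝ) :
    MeasurableSet {q : Rn n × ℝ | ‖q.1‖ < R ∧ R⁻¹ < q.2 ∧ q.2 < R} := by
  have h1 : Measurable fun q : Rn n × ℝ => ‖q.1‖ := by fun_prop
  exact (measurableSet_lt h1 measurable_const).inter
    ((measurableSet_lt measurable_const measurable_snd).inter
      (measurableSet_lt measurable_snd measurable_const))

/-- The linear `L²` bound on a bounded part of the upper half space, uniformly in the measurable
choice `i` of the test function. -/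
theorem setLIntegral_enorm_dilate_sq_le [NeZero n] (hα₀ : 0 < α) (hα₁ : α ≤ 1)
    {u : ℕ → Rn n → ℝ} (hu : ∀ i, u i ∈ testFamily n α) {i : Rn n × ℝ → ℕ} (hi : Measurable i)
    {f : Rn n → ℝ} (hf : Measurable f) (hf2 : ∫⁻ z, ‖f z‖ₑ ^ 2 ≠ ∞) {R : ℝ} (hR : 0 < R) :
    ∫⁻ q in {q : Rn n × ℝ | ‖q.1‖ < R ∧ R⁻¹ < q.2 ∧ q.2 < R},
      ‖∫ z, dilate (u (i q)) q.2 (q.1 - z) * f z‖ₑ ^ 2 * ENNReal.ofReal q.2⁻¹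
      ≤ l2Const n α * ∫⁻ z, ‖f z‖ₑ ^ 2 := by
  set K := {q : Rn n × ℝ | ‖q.1‖ < R ∧ R⁻¹ < q.2 ∧ q.2 < R} with hK
  have hKm : MeasurableSet K := measurableSet_box R
  have hKpos {q : Rn n × ℝ} (hq : q ∈ K) : 0 < q.2 := (inv_pos.2 hR).trans hq.2.1
  have hden : Measurable fun q : Rn n × ℝ => ENNReal.ofReal q.2⁻¹ := by fun_prop
  set μ : Measure (Rn n × ℝ) :=
    (volume.restrict K).withDensity (fun q => ENNReal.ofReal q.2⁻¹) with hμ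
  -- Cutting the kernel off outside `K` makes it square integrable in `z` uniformly in `q`.
  set k : Rn n × ℝ → Rn n → ℝ := fun q z =>
    K.indicator (fun q => dilate (u (i q)) q.2 (q.1 - z)) q with hk
  have hkK {q : Rn n × ℝ} (hq : q ∈ K) (z : Rn n) : k q z = dilate (u (i q)) q.2 (q.1 - z) :=
    Set.indicator_of_mem hq _
  have hk0 {q : Rn n × ℝ} (hq : q ∉ K) (z : Rn n) : k q z = 0 := Set.indicator_of_notMem hq _
  have hkm : Measurable (Function.uncurry k) := by
    have h1 : Measurable fun p : (Rn n × ℝ) × Rn n => dilate (u (i p.1)) p.1.2 (p.1.1 - p.2) := by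
      have h2 : Measurable fun p : ((Rn n × ℝ) × Rn n) × ℕ =>
          dilate (u p.2) p.1.1.2 (p.1.1.1 - p.1.2) :=
        measurable_from_prod_countable_left fun j => measurable_dilate_uncurry hα₀ (hu j)
      exact h2.comp (measurable_id.prodMk (hi.comp measurable_fst))
    exact h1.indicator (measurable_fst hKm)
  have hfin : IsFiniteMeasure μ := by
    refine isFiniteMeasure_withDensity (ne_top_of_le_ne_top ?_
      (setLIntegral_mono' (g := fun _ => ENNReal.ofReal R) hKm fun q hq => ?_))
    · rw [setLIntegral_const]
      refine ENNReal.mul_ne_top ENNReal.ofReal_ne_top (ne_top_of_le_ne_top ?_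
        (measure_mono (t := ball (0 : Rn n) R ×ˢ Set.Ioo (0 : ℝ) R) fun q hq => ?_))
      · rw [Measure.volume_eq_prod, Measure.prod_prod]
        exact ENNReal.mul_ne_top measure_ball_lt_top.ne measure_Ioo_lt_top.ne
      · exact ⟨by simpa using hq.1, hKpos hq, hq.2.2⟩
    · exact ENNReal.ofReal_le_ofReal (inv_le_of_inv_le₀ hR hq.2.1.le)
  have hM (q : Rn n × ℝ) : ∫⁻ z, ‖k q z‖ₑ ^ 2
      ≤ ENNReal.ofReal (3 * R ^ n) * (3 * volume (ball (0 : Rn n) 1)) := by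
    by_cases hq : q ∈ K
    · simp_rw [hkK hq]
      refine (lintegral_enorm_sq_dilate_le hα₀ hα₁ (hu (i q)) (hKpos hq) q.1).trans ?_
      gcongr
      rw [← inv_pow]
      have := hKpos hq
      gcongr
      exact inv_le_of_inv_le₀ hR hq.2.1.le
    · simp [hk0 hq]
  have hC (q : Rn n × ℝ) : ∫⁻ q', ‖∫ z, k q z * k q' z‖ₑ ∂μ ≤ l2Const n α := by
    by_cases hq : q ∈ K
    · have hKK : Measurable fun q' => ‖∫ z, k q z * k q' z‖ₑ := by
        refine (StronglyMeasurable.integral_prod_right'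
          (f := fun p : (Rn n × ℝ) × Rn n => k q p.2 * k p.1 p.2) ?_).measurable.enorm
        exact ((hkm.comp (measurable_const.prodMk measurable_snd)).mul hkm).stronglyMeasurable
      rw [hμ, lintegral_withDensity_eq_lintegral_mul _ hden hKK]
      refine le_trans ?_ (lintegral_enorm_integral_dilate_mul_le hα₀ hα₁ (hu (i q))
        (ψ := fun q => u (i q)) (fun q' => hu (i q')) (hKpos hq) q.1)
      refine le_trans (setLIntegral_mono' hKm fun q' hq' => ?_)
        (lintegral_mono_set fun q' hq' => hKpos hq')
      simp only [Pi.mul_apply, hkK hq, hkK hq']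
      rw [mul_comm]
    · simp [hk0 hq]
  have h := lintegral_integral_sq_le_of_schur (μ := μ) hkm (by finiteness) hM hC hf hf2
  refine le_trans (le_of_eq ?_) h
  have hT : Measurable fun q => ‖∫ z, k q z * f z‖ₑ ^ 2 :=
    (hkm.mul (hf.comp
      measurable_snd)).stronglyMeasurable.integral_prod_right'.measurable.enorm.pow_const 2
  rw [hμ, lintegral_withDensity_eq_lintegral_mul _ hden hT]
  refine setLIntegral_congr_fun hKm fun q hq => ?_
  simp only [Pi.mul_apply, hkK hq]
  rw [mul_comm]

/-- The `L²` bound for real functions. The supremum in `A_α` is linearized by choosing measurably,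
at each point, a test function that nearly attains it. -/
theorem lintegral_A_sq_le_real [NeZero n] (hα₀ : 0 < α) (hα₁ : α ≤ 1) {f : Rn n → ℝ}
    (hf : LocallyIntegrable f) (hf2 : ∫⁻ z, ‖f z‖ₑ ^ 2 ≠ ∞) :
    ∫⁻ q in {q : Rn n × ℝ | 0 < q.2}, A α f q.1 q.2 ^ 2 * ENNReal.ofReal q.2⁻¹
      ≤ 4 * l2Const n α * ∫⁻ z, ‖f z‖ₑ ^ 2 := by
  obtain ⟨f', hf', hff'⟩ := hf.aestronglyMeasurable
  have hf'l : LocallyIntegrable f' := hf.congr hff'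
  have hsq : ∫⁻ z, ‖f z‖ₑ ^ 2 = ∫⁻ z, ‖f' z‖ₑ ^ 2 := by
    refine lintegral_congr_ae ?_
    filter_upwards [hff'] with z hz
    rw [hz]
  simp_rw [A_congr_ae hff']
  rw [hsq] at hf2 ⊢
  obtain ⟨u, hu, hA⟩ := exists_seq_A_eq_iSup (n := n) ℝ hα₀ hα₁
  set T : ℕ → Rn n × ℝ → ℝ≥0∞ := fun i q => ‖∫ z, dilate (u i) q.2 (q.1 - z) * f' z‖ₑ with hT
  have hTm (i : ℕ) : Measurable (T i) := by
    have := measurable_integral_dilate hα₀ hf'l.aestronglyMeasurable (hu i)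
    simp only [smul_eq_mul] at this
    exact this.enorm
  have hsup : Measurable fun q => ⨆ i, T i q := Measurable.iSup hTm
  have hex (q : Rn n × ℝ) : ∃ i, (⨆ i, T i q) = ∞ ∨ (⨆ i, T i q) ≤ 2 * T i q := by
    by_cases h1 : (⨆ i, T i q) = ∞
    · exact ⟨0, Or.inl h1⟩
    by_cases h0 : (⨆ i, T i q) = 0
    · exact ⟨0, Or.inr (by rw [h0]; exact bot_le)⟩
    · obtain ⟨i, hi⟩ := lt_iSup_iff.1 (ENNReal.half_lt_self h0 h1)
      refine ⟨i, Or.inr ?_⟩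
      rw [mul_comm]
      exact (ENNReal.div_le_iff (by norm_num) (by norm_num)).1 hi.le
  classical
  set i : Rn n × ℝ → ℕ := fun q => Nat.find (hex q) with hi_def
  have hi : Measurable i := by
    refine measurable_find hex fun j => ?_
    exact (hsup (measurableSet_singleton _)).union
      (measurableSet_le hsup ((hTm j).const_mul 2))
  have hbound (q : Rn n × ℝ) (hq : 0 < q.2) : A α f' q.1 q.2 ≤ 2 * T (i q) q := by
    have hAq : A α f' q.1 q.2 = ⨆ i, T i q := hA f' hf'l q.1 q.2 hq
    rw [hAq]
    refine (Nat.find_spec (hex q)).resolve_left ?_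
    rw [← hAq]
    refine ne_top_of_le_ne_top (ENNReal.mul_ne_top ENNReal.ofReal_ne_top ?_)
      (A_le_setLIntegral hα₀ hα₁ f' q.1 hq)
    exact (hf'l.integrableOn_isCompact (isCompact_closedBall q.1 q.2)).2.ne
  have hunion : {q : Rn n × ℝ | 0 < q.2} =
      ⋃ N : ℕ, {q : Rn n × ℝ | ‖q.1‖ < N + 1 ∧ ((N : ℝ) + 1)⁻¹ < q.2 ∧ q.2 < N + 1} := by
    ext q
    simp only [Set.mem_ofPred_eq, Set.mem_iUnion]
    constructor
    · intro hq
      obtain ⟨N, hN⟩ := exists_nat_gt (max ‖q.1‖ (max q.2⁻¹ q.2))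
      simp only [max_lt_iff] at hN
      refine ⟨N, by linarith, inv_lt_of_inv_lt₀ hq (by linarith), by linarith⟩
    · rintro ⟨N, -, h, -⟩
      exact lt_trans (by positivity) h
  have hmono : Monotone fun N : ℕ =>
      {q : Rn n × ℝ | ‖q.1‖ < N + 1 ∧ ((N : ℝ) + 1)⁻¹ < q.2 ∧ q.2 < N + 1} := by
    intro N N' h q hq
    have h' : (N : ℝ) ≤ N' := by exact_mod_cast h
    have h1 : ((N' : ℝ) + 1)⁻¹ ≤ ((N : ℝ) + 1)⁻¹ := by gcongr
    exact ⟨by linarith [hq.1], by linarith [hq.2.1], by linarith [hq.2.2]⟩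
  rw [hunion, setLIntegral_iUnion_of_directed _ hmono.directed_le]
  refine iSup_le fun N => ?_
  calc _ ≤ ∫⁻ q in {q : Rn n × ℝ | ‖q.1‖ < N + 1 ∧ ((N : ℝ) + 1)⁻¹ < q.2 ∧ q.2 < N + 1},
        4 * (T (i q) q ^ 2 * ENNReal.ofReal q.2⁻¹) := by
        refine setLIntegral_mono' (measurableSet_box _) fun q hq => ?_
        rw [← mul_assoc]
        gcongr
        refine (pow_le_pow_left' (hbound q (lt_trans (by positivity) hq.2.1)) 2).trans_eq ?_
        rw [mul_pow]
        norm_num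
    _ ≤ _ := by
        rw [lintegral_const_mul' _ _ (by norm_num), mul_assoc]
        gcongr
        exact setLIntegral_enorm_dilate_sq_le hα₀ hα₁ hu hi hf'.measurable hf2 (by positivity)

theorem A_le_re_add_im (hα₀ : 0 < α) {f : Rn n → 𝕜} (hf : LocallyIntegrable f)
    (y : Rn n) {t : ℝ} (ht : 0 < t) :
    A α f y t ≤ A α (fun z => RCLike.re (f z)) y t + A α (fun z => RCLike.im (f z)) y t := by
  refine iSup₂_le fun φ hφ => ?_
  have hint := integrable_dilate_smul hα₀ hf hφ ht y
  refine le_trans ?_ (add_le_add (enorm_le_A hφ y t) (enorm_le_A hφ y t))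
  have h1 : ∫ z, dilate φ t (y - z) • RCLike.re (f z)
      = RCLike.re (∫ z, dilate φ t (y - z) • f z) := by
    rw [← RCLike.reCLM_apply, ← RCLike.reCLM.integral_comp_comm hint]
    simp
  have h2 : ∫ z, dilate φ t (y - z) • RCLike.im (f z)
      = RCLike.im (∫ z, dilate φ t (y - z) • f z) := by
    rw [← RCLike.imCLM_apply, ← RCLike.imCLM.integral_comp_comm hint]
    simp
  rw [h1, h2]
  set w := ∫ z, dilate φ t (y - z) • f z
  rw [← ofReal_norm, ← ofReal_norm, ← ofReal_norm,
    ← ENNReal.ofReal_add (norm_nonneg _) (norm_nonneg _)]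
  refine ENNReal.ofReal_le_ofReal ?_
  have h3 := norm_add_le (RCLike.re w : 𝕜) (RCLike.im w * RCLike.I)
  rw [RCLike.re_add_im, norm_mul, RCLike.norm_ofReal, RCLike.norm_ofReal] at h3
  have h4 : ‖(RCLike.I : 𝕜)‖ ≤ 1 := by
    rw [RCLike.norm_I]
    split_ifs <;> norm_num
  refine h3.trans (add_le_add le_rfl (mul_le_of_le_one_right (abs_nonneg _) h4))

/-- The `L²` bound for the intrinsic square function. -/
theorem lintegral_S_sq_le [NeZero n] (hα₀ : 0 < α) (hα₁ : α ≤ 1) {f : Rn n → 𝕜}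
    (hf : LocallyIntegrable f) (hf2 : ∫⁻ z, ‖f z‖ₑ ^ 2 ≠ ∞) :
    ∫⁻ x, S α f x ^ 2
      ≤ volume (ball (0 : Rn n) 1) * (16 * l2Const n α) * ∫⁻ z, ‖f z‖ₑ ^ 2 := by
  rw [lintegral_S_sq hα₀ hα₁ hf, mul_assoc]
  gcongr
  have hpos : MeasurableSet {q : Rn n × ℝ | 0 < q.2} :=
    measurableSet_lt measurable_const measurable_snd
  have hre : LocallyIntegrable fun z => RCLike.re (f z) := fun x => by
    obtain ⟨s, hs, h⟩ := hf x
    exact ⟨s, hs, h.re⟩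
  have him : LocallyIntegrable fun z => RCLike.im (f z) := fun x => by
    obtain ⟨s, hs, h⟩ := hf x
    exact ⟨s, hs, h.im⟩
  have hre2 : ∫⁻ z, ‖RCLike.re (f z)‖ₑ ^ 2 ≤ ∫⁻ z, ‖f z‖ₑ ^ 2 := by
    refine lintegral_mono fun z => pow_le_pow_left' ?_ 2
    exact enorm_le_iff_norm_le.2 (RCLike.norm_re_le_norm _)
  have him2 : ∫⁻ z, ‖RCLike.im (f z)‖ₑ ^ 2 ≤ ∫⁻ z, ‖f z‖ₑ ^ 2 := by
    refine lintegral_mono fun z => pow_le_pow_left' ?_ 2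
    exact enorm_le_iff_norm_le.2 (RCLike.norm_im_le_norm _)
  obtain ⟨F, hF, hAF⟩ := exists_measurable_eq_A hα₀ hα₁ hre
  calc _ ≤ ∫⁻ q in {q : Rn n × ℝ | 0 < q.2},
        2 * (A α (fun z => RCLike.re (f z)) q.1 q.2 ^ 2 * ENNReal.ofReal q.2⁻¹
          + A α (fun z => RCLike.im (f z)) q.1 q.2 ^ 2 * ENNReal.ofReal q.2⁻¹) := by
        refine setLIntegral_mono' hpos fun q hq => ?_
        rw [← add_mul, ← mul_assoc]
        gcongr
        refine (pow_le_pow_left' (A_le_re_add_im hα₀ hf q.1 hq) 2).trans ?_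
        have := ENNReal.rpow_add_le_mul_rpow_add_rpow
          (A α (fun z => RCLike.re (f z)) q.1 q.2) (A α (fun z => RCLike.im (f z)) q.1 q.2)
          (p := 2) (by norm_num)
        norm_num at this
        exact this
    _ ≤ 2 * (4 * l2Const n α * (∫⁻ z, ‖f z‖ₑ ^ 2) + 4 * l2Const n α * ∫⁻ z, ‖f z‖ₑ ^ 2) := by
        rw [lintegral_const_mul' _ _ (by norm_num), lintegral_add_left']
        · gcongr
          · exact (lintegral_A_sq_le_real hα₀ hα₁ hre (ne_top_of_le_ne_top hf2 hre2)).trans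
              (mul_le_mul_right hre2 _)
          · exact (lintegral_A_sq_le_real hα₀ hα₁ him (ne_top_of_le_ne_top hf2 him2)).trans
              (mul_le_mul_right him2 _)
        · refine ⟨fun q => F q ^ 2 * ENNReal.ofReal q.2⁻¹, by fun_prop, ?_⟩
          filter_upwards [ae_restrict_mem hpos] with q hq
          rw [hAF q hq]
    _ = _ := by ring

/-! ### Atoms, and the selection of balls -/

/-- Proved by writing `‖x - c‖^{-(n+α)}` as the integral of `(n+α) τ^{-(n+α)-1}` over `τ > ‖x - c‖`
and integrating in `x` first. -/
theorem lintegral_compl_closedBall_rpow_le (hα₀ : 0 < α) (c : Rn n) {r : ℝ} (hr : 0 < r) :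
    ∫⁻ x in (closedBall c r)ᶜ, ENNReal.ofReal (‖x - c‖ ^ (-(n + α)))
      ≤ ENNReal.ofReal ((n + α) / α) * volume (ball (0 : Rn n) 1) * ENNReal.ofReal (r ^ (-α)) := by
  have hs : 0 < n + α := by positivity
  set v := volume (ball (0 : Rn n) 1) with hv
  have hset : MeasurableSet {p : Rn n × ℝ | r < p.2 ∧ ‖p.1 - c‖ < p.2} := by
    have h1 : Measurable fun p : Rn n × ℝ => ‖p.1 - c‖ := by fun_prop
    exact (measurableSet_lt measurable_const measurable_snd).inter
      (measurableSet_lt h1 measurable_snd)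
  set G : Rn n × ℝ → ℝ≥0∞ := {p : Rn n × ℝ | r < p.2 ∧ ‖p.1 - c‖ < p.2}.indicator
    (fun p => ENNReal.ofReal (p.2 ^ (-(n + α) - 1))) with hG
  have hGm : Measurable G := Measurable.indicator (by fun_prop) hset
  calc _ ≤ ∫⁻ x in (closedBall c r)ᶜ, ENNReal.ofReal (n + α) * ∫⁻ τ, G (x, τ) := by
        refine setLIntegral_mono' measurableSet_closedBall.compl fun x hx => ?_
        have hd : r < ‖x - c‖ := by
          rw [← dist_eq_norm]
          simpa using hx
        have h1 : ∫⁻ τ in Set.Ioi ‖x - c‖, ENNReal.ofReal (τ ^ (-(n + α) - 1))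
            ≤ ∫⁻ τ, G (x, τ) := by
          rw [← lintegral_indicator measurableSet_Ioi]
          refine lintegral_mono fun τ => ?_
          by_cases hτ : ‖x - c‖ < τ
          · rw [Set.indicator_of_mem (Set.mem_Ioi.2 hτ), hG,
              Set.indicator_of_mem (by exact ⟨hd.trans hτ, hτ⟩)]
          · rw [Set.indicator_of_notMem (by simpa using hτ)]
            exact bot_le
        rw [lintegral_Ioi_rpow (hr.trans hd) hs] at h1
        refine le_trans (le_of_eq ?_) (mul_le_mul_right h1 _)
        rw [← ENNReal.ofReal_mul hs.le]
        congr 1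
        field_simp
    _ ≤ ∫⁻ x, ENNReal.ofReal (n + α) * ∫⁻ τ, G (x, τ) := setLIntegral_le_lintegral _ _
    _ = ENNReal.ofReal (n + α) * ∫⁻ τ, ∫⁻ x, G (x, τ) := by
        rw [lintegral_const_mul _ hGm.lintegral_prod_right',
          lintegral_lintegral_swap (f := fun x τ => G (x, τ)) hGm.aemeasurable]
    _ = ENNReal.ofReal (n + α) * ∫⁻ τ in Set.Ioi r, v * ENNReal.ofReal (τ ^ (-α - 1)) := by
        congr 1
        rw [← lintegral_indicator measurableSet_Ioi]
        refine lintegral_congr fun τ => ?_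
        by_cases hτ : r < τ
        · have hτ0 := hr.trans hτ
          have h2 (x : Rn n) : G (x, τ) = (ball c τ).indicator
              (fun _ => ENNReal.ofReal (τ ^ (-(n + α) - 1))) x := by
            by_cases hx : x ∈ ball c τ
            · rw [Set.indicator_of_mem hx, hG, Set.indicator_of_mem]
              exact ⟨hτ, by rwa [mem_ball_iff_norm] at hx⟩
            · rw [Set.indicator_of_notMem hx, hG, Set.indicator_of_notMem]
              exact fun h => hx (by rw [mem_ball_iff_norm]; exact h.2)
          simp_rw [h2]
          rw [lintegral_indicator_const measurableSet_ball, volume_ball_eq _ hτ0,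
            Set.indicator_of_mem (Set.mem_Ioi.2 hτ), ← mul_assoc,
            ← ENNReal.ofReal_mul (by positivity), mul_comm]
          congr 2
          rw [← Real.rpow_natCast, ← Real.rpow_add hτ0]
          congr 1
          ring
        · have h2 (x : Rn n) : G (x, τ) = 0 := Set.indicator_of_notMem (fun h => hτ h.1) _
          simp [h2, hτ]
    _ = _ := by
        rw [lintegral_const_mul _ (by fun_prop), lintegral_Ioi_rpow hr hα₀, div_eq_mul_inv,
          div_eq_mul_inv, ENNReal.ofReal_mul (p := r ^ (-α)) (by positivity),
          ENNReal.ofReal_mul hs.le]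
        ring

/-- The constant in the estimate of `S_α` of an atom away from its support. -/
noncomputable def atomConst (n : ℕ) (α : ℝ) : ℝ≥0∞ :=
  (volume (ball (0 : Rn n) 1) * ENNReal.ofReal (2 * (n + α))⁻¹) ^ (1 / 2 : ℝ) *
    ENNReal.ofReal (4 ^ ((n : ℝ) + α)) *
    (ENNReal.ofReal ((n + α) / α) * volume (ball (0 : Rn n) 1))

theorem atomConst_ne_top : atomConst n α ≠ ∞ := by
  have : volume (ball (0 : Rn n) 1) ≠ ∞ := measure_ball_lt_top.ne
  have h2 : (volume (ball (0 : Rn n) 1) * ENNReal.ofReal (2 * (n + α))⁻¹) ^ (1 / 2 : ℝ) ≠ ∞ :=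
    ENNReal.rpow_ne_top_of_nonneg (by norm_num) (by finiteness)
  unfold atomConst
  finiteness

/-- Away from its support, the square function of a function of integral zero is integrable. -/
theorem setLIntegral_S_le_of_integral_eq_zero [NeZero n] (hα₀ : 0 < α) {b : Rn n → 𝕜}
    (hb : Integrable b) (hb0 : ∫ z, b z = 0) {c : Rn n} {ρ : ℝ} (hρ0 : 0 < ρ)
    (hρ : ∀ z ∉ closedBall c ρ, b z = 0) :
    ∫⁻ x in (closedBall c (4 * ρ))ᶜ, S α b x ≤ atomConst n α * ∫⁻ z, ‖b z‖ₑ := by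
  have hs : 0 < n + α := by positivity
  set W := (volume (ball (0 : Rn n) 1) * ENNReal.ofReal (2 * (n + α))⁻¹) ^ (1 / 2 : ℝ) with hW
  have hWt : W ≠ ∞ := by
    have : volume (ball (0 : Rn n) 1) ≠ ∞ := measure_ball_lt_top.ne
    exact ENNReal.rpow_ne_top_of_nonneg (by norm_num) (by finiteness)
  set B := ∫⁻ z, ‖b z‖ₑ with hB
  have hBt : B ≠ ∞ := hb.2.ne
  have hpt : ∀ x ∈ (closedBall c (4 * ρ))ᶜ, S α b x ≤ W * (ENNReal.ofReal (ρ ^ α) * B) *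
      ENNReal.ofReal (4 ^ ((n : ℝ) + α)) * ENNReal.ofReal (‖x - c‖ ^ (-(n + α))) := by
    intro x hx
    have hd : 4 * ρ < ‖x - c‖ := by
      rw [← dist_eq_norm]
      simpa using hx
    have hd0 : 0 < ‖x - c‖ := by linarith
    have h := S_le_of_A_le (f := b) (x := x) (a := ‖x - c‖ / 4) (β := n + α)
      (c := ENNReal.ofReal (ρ ^ α) * B) (α := α) (by positivity) hs ?_ ?_
    · refine h.trans_eq ?_
      rw [Real.div_rpow hd0.le (by norm_num), Real.rpow_neg (by norm_num : (0 : ℝ) ≤ 4),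
        div_inv_eq_mul, ENNReal.ofReal_mul (by positivity)]
      ring
    · -- Below height `‖x - c‖ / 4`, the ball of radius `t` around `y` misses the support of `b`.
      intro y t ht hxy hta
      refine A_eq_zero ht fun z hz => hρ z fun hzc => ?_
      rw [mem_closedBall] at hz hzc
      have h1 := dist_triangle4 x y z c
      rw [dist_eq_norm x y, dist_comm y z, dist_eq_norm x c] at h1
      linarith
    · intro y t hta hxy
      have ht : 0 < t := lt_trans (by positivity) hta
      refine (A_le_of_integral_eq_zero hα₀ hb hb0 hρ y ht).trans_eq ?_
      rw [mul_right_comm, ← ENNReal.ofReal_mul (by positivity), Real.div_rpow hρ0.le ht.le]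
      congr 2
      rw [neg_add, Real.rpow_add ht, Real.rpow_neg ht.le, Real.rpow_neg ht.le, Real.rpow_natCast]
      ring
  refine (setLIntegral_mono' measurableSet_closedBall.compl hpt).trans ?_
  rw [lintegral_const_mul' _ _ (by finiteness)]
  refine (mul_le_mul_right (lintegral_compl_closedBall_rpow_le hα₀ c (by positivity)) _).trans ?_
  have h1 : ENNReal.ofReal (ρ ^ α) * ENNReal.ofReal ((4 * ρ) ^ (-α)) ≤ 1 := by
    rw [← ENNReal.ofReal_mul (by positivity), Real.mul_rpow (by norm_num) hρ0.le,
      Real.rpow_neg hρ0.le, mul_left_comm, mul_inv_cancel₀ (by positivity), mul_one]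
    exact ENNReal.ofReal_le_one.2
      (Real.rpow_le_one_of_one_le_of_nonpos (by norm_num) (by linarith))
  calc _ = (ENNReal.ofReal (ρ ^ α) * ENNReal.ofReal ((4 * ρ) ^ (-α))) * (atomConst n α * B) := by
        rw [atomConst, ← hW]
        ring
    _ ≤ 1 * (atomConst n α * B) := by gcongr
    _ = _ := one_mul _

/-- Selection of the balls of the Calderón–Zygmund decomposition at height `l`: disjoint balls on
which the average of `‖f‖` exceeds `l`, whose fivefold enlargements have average at most `l` and
cover, up to a null set, the points where `‖f‖ > l`. -/
theorem exists_disjoint_closedBall_average [NeZero n] {f : Rn n → 𝕜} (hf : Integrable f) {l : ℝ}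
    (hl : 0 < l) :
    ∃ u : Set (Rn n × ℝ), u.Countable ∧ (∀ a ∈ u, 0 < a.2) ∧
      (u.PairwiseDisjoint fun a => closedBall a.1 a.2) ∧
      (∀ a ∈ u, ENNReal.ofReal l * volume (closedBall a.1 a.2)
        ≤ ∫⁻ z in closedBall a.1 a.2, ‖f z‖ₑ) ∧
      (∀ a ∈ u, ∫⁻ z in closedBall a.1 (5 * a.2), ‖f z‖ₑ
        ≤ ENNReal.ofReal l * volume (closedBall a.1 (5 * a.2))) ∧
      ∀ᵐ x, x ∉ ⋃ a ∈ u, closedBall a.1 (5 * a.2) → ‖f x‖ ≤ l := by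
  set F := ∫⁻ z, ‖f z‖ₑ with hF
  have hFt : F ≠ ∞ := hf.2.ne
  set v := volume (ball (0 : Rn n) 1) with hv
  have hvt : v ≠ ∞ := measure_ball_lt_top.ne
  have hv0 : v ≠ 0 := (measure_ball_pos _ _ one_pos).ne'
  set Bad : Rn n → ℝ → Prop := fun x r => ENNReal.ofReal l * volume (closedBall x r)
    < ∫⁻ z in closedBall x r, ‖f z‖ₑ with hBad
  set R : ℝ := max 1 (F / (ENNReal.ofReal l * v)).toReal with hR
  have hbound (x : Rn n) (r : ℝ) (hr : 0 < r) (h : Bad x r) : r ≤ R := by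
    by_contra! hlt
    have hr1 : 1 ≤ r := (le_max_left _ _).trans hlt.le
    have h1 : ENNReal.ofReal l * (ENNReal.ofReal (r ^ n) * v) ≤ F := by
      rw [← volume_closedBall_eq x hr]
      exact h.le.trans (setLIntegral_le_lintegral _ _)
    have hne0 : ENNReal.ofReal l * v ≠ 0 := mul_ne_zero (by simpa using hl) hv0
    have hnet : ENNReal.ofReal l * v ≠ ∞ := by finiteness
    have h2 : ENNReal.ofReal (r ^ n) ≤ F / (ENNReal.ofReal l * v) := by
      rw [ENNReal.le_div_iff_mul_le (Or.inl hne0) (Or.inl hnet)]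
      refine le_trans (le_of_eq ?_) h1
      ring
    have h3 : r ^ n ≤ (F / (ENNReal.ofReal l * v)).toReal :=
      (ENNReal.ofReal_le_iff_le_toReal (ENNReal.div_ne_top hFt hne0)).1 h2
    have h4 : r ≤ r ^ n := le_self_pow₀ hr1 (NeZero.ne n)
    exact absurd (h4.trans (h3.trans (le_max_right 1 _))) (not_le.2 hlt)
  -- Pairs `(x, r)` with `r` within a factor of two of the largest bad radius at `x`.
  set T : Set (Rn n × ℝ) := {a | 0 < a.2 ∧ Bad a.1 a.2 ∧ ∀ s, 2 * a.2 ≤ s → ¬ Bad a.1 s} with hT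
  obtain ⟨u, huT, hdisj, hcov⟩ := Vitali.exists_disjoint_subfamily_covering_enlargement_closedBall
    T (fun a => a.1) (fun a => a.2) R (fun a ha => hbound a.1 a.2 ha.1 ha.2.1) 5 (by norm_num)
  refine ⟨u, ?_, fun a ha => (huT ha).1, hdisj, fun a ha => (huT ha).2.1.le, fun a ha => ?_, ?_⟩
  · refine hdisj.countable_of_nonempty_interior fun a ha => ?_
    exact ⟨a.1, ball_subset_interior_closedBall (mem_ball_self (huT ha).1)⟩
  · exact not_lt.1 ((huT ha).2.2 _ (by linarith [(huT ha).1]))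
  · have hdiff := IsUnifLocDoublingMeasure.ae_tendsto_average (volume : Measure (Rn n))
      hf.norm.locallyIntegrable 1
    filter_upwards [hdiff] with x hx hxu
    -- No radius is bad at `x`: otherwise a near maximal one puts `x` into the union.
    have hgood : ∀ r, 0 < r → ¬ Bad x r := by
      intro r hr hbad
      apply hxu
      set Rx : Set ℝ := {r | 0 < r ∧ Bad x r} with hRx
      have hne : Rx.Nonempty := ⟨r, hr, hbad⟩
      have hbdd : BddAbove Rx := ⟨R, fun s hs => hbound x s hs.1 hs.2⟩
      have hsup : 0 < sSup Rx := hr.trans_le (le_csSup hbdd ⟨hr, hbad⟩)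
      obtain ⟨r₁, hr₁, hlt⟩ := exists_lt_of_lt_csSup hne (half_lt_self hsup)
      have hmem : (x, r₁) ∈ T := by
        refine ⟨hr₁.1, hr₁.2, fun s hs hbs => ?_⟩
        simp only at hs
        have := le_csSup hbdd (⟨by linarith [hr₁.1], hbs⟩ : s ∈ Rx)
        linarith
      obtain ⟨b, hb, hsub⟩ := hcov _ hmem
      exact Set.mem_biUnion hb (hsub (mem_closedBall_self hr₁.1.le))
    have hlim := hx (l := 𝓝[>] (0 : ℝ)) (fun _ => x) (fun δ => δ) tendsto_id (by
      filter_upwards [self_mem_nhdsWithin] with δ hδ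
      exact mem_closedBall_self (by simpa using (le_of_lt hδ : (0 : ℝ) ≤ δ)))
    refine le_of_tendsto hlim ?_
    filter_upwards [self_mem_nhdsWithin] with δ hδ
    have hδ0 : 0 < δ := hδ
    have hg := not_lt.1 (hgood δ hδ0)
    have hvol : volume (closedBall x δ) ≠ ∞ := measure_closedBall_lt_top.ne
    have hvol0 : 0 < volume.real (closedBall x δ) :=
      ENNReal.toReal_pos (measure_closedBall_pos _ _ hδ0).ne' hvol
    rw [setAverage_eq, smul_eq_mul, inv_mul_le_iff₀ hvol0,
      integral_norm_eq_lintegral_enorm hf.1.restrict]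
    refine (ENNReal.toReal_mono (by finiteness) hg).trans_eq ?_
    rw [ENNReal.toReal_mul, ENNReal.toReal_ofReal hl.le, mul_comm]
    rfl

/-! ### The Calderón–Zygmund decomposition and the weak `(1,1)` inequality -/

theorem exists_disjoint_measurableSet_subset {X ι : Type*} [MeasurableSpace X] [Countable ι]
    {E : ι → Set X} (hE : ∀ i, MeasurableSet (E i)) :
    ∃ Q : ι → Set X, (∀ i, MeasurableSet (Q i)) ∧ Pairwise (Function.onFun Disjoint Q) ∧
      (∀ i, Q i ⊆ E i) ∧ ⋃ i, Q i = ⋃ i, E i := by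
  obtain ⟨e, he⟩ := Countable.exists_injective_nat ι
  refine ⟨fun i => E i \ ⋃ j ∈ {j | e j < e i}, E j, fun i => ?_, fun i j hij => ?_,
    fun i => Set.sdiff_subset, ?_⟩
  · exact (hE i).diff (MeasurableSet.biUnion (Set.to_countable _) fun j _ => hE j)
  · have key (i j : ι) (h : e i < e j) : Disjoint (E i \ ⋃ k ∈ {k | e k < e i}, E k)
        (E j \ ⋃ k ∈ {k | e k < e j}, E k) :=
      Set.disjoint_left.2 fun x hx hx' => hx'.2 (Set.mem_biUnion h hx.1)
    rcases lt_or_gt_of_ne (he.ne hij) with h | h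
    · exact key i j h
    · exact (key j i h).symm
  · refine Set.Subset.antisymm (Set.iUnion_mono fun i => Set.sdiff_subset) fun x hx => ?_
    classical
    have hex : ∃ k, ∃ i, e i = k ∧ x ∈ E i := by
      obtain ⟨i, hi⟩ := Set.mem_iUnion.1 hx
      exact ⟨e i, i, rfl, hi⟩
    obtain ⟨i, hik, hi⟩ := Nat.find_spec hex
    refine Set.mem_iUnion.2 ⟨i, hi, fun h => ?_⟩
    obtain ⟨j, hj, hxj⟩ := Set.mem_iUnion₂.1 h
    exact Nat.find_min hex (hik ▸ hj) ⟨j, rfl, hxj⟩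

theorem hasSum_indicator_of_mem {X ι M : Type*} [AddCommMonoid M] [TopologicalSpace M]
    {B : ι → Set X} (hB : Pairwise (Function.onFun Disjoint B)) (F : ι → X → M) {x : X} {i : ι}
    (hx : x ∈ B i) : HasSum (fun j => (B j).indicator (F j) x) (F i x) := by
  have := hasSum_single (f := fun j => (B j).indicator (F j) x) i fun j hj =>
    Set.indicator_of_notMem (Set.disjoint_left.1 (hB hj.symm) hx) _
  rwa [Set.indicator_of_mem hx] at this

theorem hasSum_indicator_of_notMem {X ι M : Type*} [AddCommMonoid M] [TopologicalSpace M]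
    {B : ι → Set X} (F : ι → X → M) {x : X} (hx : x ∉ ⋃ i, B i) :
    HasSum (fun j => (B j).indicator (F j) x) 0 := by
  have h0 (j : ι) : (B j).indicator (F j) x = 0 :=
    Set.indicator_of_notMem (fun h => hx (Set.mem_iUnion.2 ⟨j, h⟩)) _
  simp [h0]

/-- The Calderón–Zygmund decomposition `f = g + ∑ b i` at height `l`. The mean of the part of `f`
collected near the `i`-th ball is put back as a constant on that ball itself, rather than on the
piece of its enlargement that was cut out; the balls being disjoint, `g` stays bounded. -/
theorem exists_calderonZygmund [NeZero n] {f : Rn n → 𝕜} (hf : Integrable f) {l : ℝ}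
    (hl : 0 < l) :
    ∃ (ι : Type) (_ : Countable ι) (c : ι → Rn n) (r : ι → ℝ) (g : Rn n → 𝕜) (b : ι → Rn n → 𝕜),
      (∀ i, 0 < r i) ∧ Integrable g ∧ (∀ᵐ x, ‖g x‖ₑ ≤ (1 + 5 ^ n) * ENNReal.ofReal l) ∧
      ∫⁻ x, ‖g x‖ₑ ≤ 2 * ∫⁻ x, ‖f x‖ₑ ∧
      (∀ i, Integrable (b i)) ∧ (∀ i, ∫ x, b i x = 0) ∧
      (∀ i, ∀ x ∉ closedBall (c i) (5 * r i), b i x = 0) ∧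
      ∑' i, ∫⁻ x, ‖b i x‖ₑ ≤ 2 * ∫⁻ x, ‖f x‖ₑ ∧
      (f = g + fun x => ∑' i, b i x) ∧
      ENNReal.ofReal l * ∑' i, volume (closedBall (c i) (r i)) ≤ ∫⁻ x, ‖f x‖ₑ := by
  obtain ⟨u, hu, hpos, hdisj, hlow, hup, hae⟩ := exists_disjoint_closedBall_average hf hl
  have hcount : Countable u := hu.to_subtype
  set B : u → Set (Rn n) := fun i => closedBall i.1.1 i.1.2 with hB
  have hBm (i : u) : MeasurableSet (B i) := measurableSet_closedBall
  have hBdisj : Pairwise (Function.onFun Disjoint B) := fun i j hij =>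
    hdisj i.2 j.2 (fun h => hij (Subtype.ext h))
  have hBt (i : u) : volume (B i) ≠ ∞ := measure_closedBall_lt_top.ne
  have hBr (i : u) : 0 < volume.real (B i) :=
    ENNReal.toReal_pos (measure_closedBall_pos _ _ (hpos _ i.2)).ne' (hBt i)
  have hB0 (i : u) : volume (B i) ≠ 0 := (measure_closedBall_pos _ _ (hpos _ i.2)).ne'
  obtain ⟨Q, hQm, hQdisj, hQE, hQU⟩ := exists_disjoint_measurableSet_subset
    (E := fun i : u => closedBall i.1.1 (5 * i.1.2)) (fun i => measurableSet_closedBall)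
  set F := ∫⁻ x, ‖f x‖ₑ with hF
  have hQsum : ∑' i, ∫⁻ x in Q i, ‖f x‖ₑ ≤ F := by
    rw [← lintegral_iUnion hQm hQdisj]
    exact setLIntegral_le_lintegral _ _
  set m : u → 𝕜 := fun i => (volume.real (B i))⁻¹ • ∫ x in Q i, f x with hm
  have hmB (i : u) : ‖m i‖ₑ * volume (B i) ≤ ∫⁻ x in Q i, ‖f x‖ₑ := by
    rw [hm]
    simp only
    rw [enorm_smul, mul_right_comm]
    have h1 : ‖(volume.real (B i))⁻¹‖ₑ * volume (B i) = 1 := by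
      rw [Real.enorm_of_nonneg (by positivity), ENNReal.ofReal_inv_of_pos (hBr i),
        Measure.real, ENNReal.ofReal_toReal (hBt i),
        ENNReal.inv_mul_cancel (hB0 i) (hBt i)]
    rw [h1, one_mul]
    exact enorm_integral_le_lintegral_enorm _
  have hml (i : u) : ‖m i‖ₑ ≤ 5 ^ n * ENNReal.ofReal l := by
    refine (ENNReal.mul_le_mul_iff_left (hB0 i) (hBt i)).1 ((hmB i).trans ?_)
    refine (lintegral_mono_set (hQE i)).trans ((hup _ i.2).trans_eq ?_)
    have h0 := hpos _ i.2
    rw [hB]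
    simp only
    rw [volume_closedBall_eq _ h0, volume_closedBall_eq _ (by positivity), mul_pow,
      ENNReal.ofReal_mul (by positivity), ENNReal.ofReal_pow (by norm_num)]
    norm_num
    ring
  set h : Rn n → 𝕜 := fun x => ∑' i, (B i).indicator (fun _ => m i) x with hh
  have hhm : Measurable h := Measurable.tsum fun i => measurable_const.indicator (hBm i)
  have hind (i : u) : ∫⁻ x, ‖(B i).indicator (fun _ => m i) x‖ₑ = ‖m i‖ₑ * volume (B i) := by
    simp_rw [enorm_indicator_eq_indicator_enorm]
    rw [lintegral_indicator_const (hBm i)]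
  have hhint : ∫⁻ x, ‖h x‖ₑ ≤ F := by
    calc ∫⁻ x, ‖h x‖ₑ ≤ ∫⁻ x, ∑' i, ‖(B i).indicator (fun _ => m i) x‖ₑ :=
          lintegral_mono fun x => enorm_tsum_le_tsum_enorm
      _ = ∑' i, ‖m i‖ₑ * volume (B i) := by
          rw [lintegral_tsum fun i => (measurable_const.indicator (hBm i)).enorm.aemeasurable]
          simp_rw [hind]
      _ ≤ F := (ENNReal.tsum_le_tsum hmB).trans hQsum
  have hhl (x : Rn n) : ‖h x‖ₑ ≤ 5 ^ n * ENNReal.ofReal l := by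
    by_cases hx : x ∈ ⋃ i, B i
    · obtain ⟨i, hi⟩ := Set.mem_iUnion.1 hx
      rw [hh]
      simp only
      rw [(hasSum_indicator_of_mem hBdisj (fun i _ => m i) hi).tsum_eq]
      exact hml i
    · rw [hh]
      simp only
      rw [(hasSum_indicator_of_notMem (fun i _ => m i) hx).tsum_eq]
      simp
  have hUm : MeasurableSet (⋃ i, Q i) := MeasurableSet.iUnion hQm
  refine ⟨u, hcount, fun i => i.1.1, fun i => i.1.2, fun x => (⋃ i, Q i)ᶜ.indicator f x + h x,
    fun i x => (Q i).indicator f x - (B i).indicator (fun _ => m i) x, fun i => hpos _ i.2,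
    ?_, ?_, ?_, ?_, ?_, ?_, ?_, ?_, ?_⟩
  · exact (hf.indicator hUm.compl).add ⟨hhm.aestronglyMeasurable,
      lt_of_le_of_lt hhint hf.2⟩
  · filter_upwards [hae] with x hx
    refine (enorm_add_le _ _).trans ?_
    rw [add_mul, one_mul]
    refine add_le_add ?_ (hhl x)
    by_cases hxQ : x ∈ (⋃ i, Q i)ᶜ
    · rw [Set.indicator_of_mem hxQ, ← ofReal_norm]
      refine ENNReal.ofReal_le_ofReal (hx fun hx' => hxQ ?_)
      rw [hQU]
      obtain ⟨a, ha, hxa⟩ := Set.mem_iUnion₂.1 hx'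
      exact Set.mem_iUnion.2 ⟨⟨a, ha⟩, hxa⟩
    · rw [Set.indicator_of_notMem hxQ]
      simp
  · calc _ ≤ ∫⁻ x, ‖f x‖ₑ + ‖h x‖ₑ := by
          refine lintegral_mono fun x => (enorm_add_le _ _).trans (add_le_add ?_ le_rfl)
          exact enorm_indicator_le_enorm_self _ _
      _ ≤ 2 * F := by
          rw [lintegral_add_right _ hhm.enorm, two_mul]
          exact add_le_add le_rfl hhint
  · exact fun i => (hf.indicator (hQm i)).sub
      ((integrable_indicator_iff (hBm i)).2 (integrableOn_const (hBt i)))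
  · intro i
    rw [integral_sub (hf.indicator (hQm i))
      ((integrable_indicator_iff (hBm i)).2 (integrableOn_const (hBt i))),
      integral_indicator (hQm i), integral_indicator (hBm i), setIntegral_const, hm, smul_smul,
      mul_inv_cancel₀ (hBr i).ne', one_smul, sub_self]
  · intro i x hx
    simp only
    rw [Set.indicator_of_notMem (fun h => hx (hQE i h)), Set.indicator_of_notMem, sub_zero]
    exact fun h => hx (closedBall_subset_closedBall (by linarith [hpos _ i.2]) h)
  · calc _ ≤ ∑' i, (∫⁻ x in Q i, ‖f x‖ₑ) + ∑' i, ∫⁻ x in Q i, ‖f x‖ₑ := by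
          rw [← ENNReal.tsum_add]
          refine ENNReal.tsum_le_tsum fun i => ?_
          calc _ ≤ ∫⁻ x, ‖(Q i).indicator f x‖ₑ + ‖(B i).indicator (fun _ => m i) x‖ₑ :=
                lintegral_mono fun x => enorm_sub_le
            _ = (∫⁻ x in Q i, ‖f x‖ₑ) + ‖m i‖ₑ * volume (B i) := by
                rw [lintegral_add_right _ (measurable_const.indicator (hBm i)).enorm, hind]
                simp_rw [enorm_indicator_eq_indicator_enorm]
                rw [lintegral_indicator (hQm i)]
            _ ≤ _ := add_le_add le_rfl (hmB i)
      _ ≤ 2 * F := by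
          rw [two_mul]
          exact add_le_add hQsum hQsum
  · funext x
    simp only [Pi.add_apply]
    have hBs : Summable fun i => (B i).indicator (fun _ => m i) x := by
      by_cases hx : x ∈ ⋃ i, B i
      · obtain ⟨i, hi⟩ := Set.mem_iUnion.1 hx
        exact (hasSum_indicator_of_mem hBdisj (fun i _ => m i) hi).summable
      · exact (hasSum_indicator_of_notMem (fun i _ => m i) hx).summable
    have hQs : HasSum (fun i => (Q i).indicator f x) ((⋃ i, Q i).indicator f x) := by
      by_cases hx : x ∈ ⋃ i, Q i
      · rw [Set.indicator_of_mem hx]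
        obtain ⟨i, hi⟩ := Set.mem_iUnion.1 hx
        exact hasSum_indicator_of_mem hQdisj (fun _ => f) hi
      · rw [Set.indicator_of_notMem hx]
        exact hasSum_indicator_of_notMem (fun _ => f) hx
    rw [hQs.summable.tsum_sub hBs, hQs.tsum_eq]
    conv_lhs => rw [← Set.indicator_self_add_compl (⋃ i, Q i) f]
    simp only [Pi.add_apply, hh]
    ring
  · rw [← ENNReal.tsum_mul_left]
    refine (ENNReal.tsum_le_tsum fun i : u => hlow _ i.2).trans ?_
    rw [← lintegral_iUnion hBm hBdisj]
    exact setLIntegral_le_lintegral _ _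

/-- The constant in the weak `(1,1)` inequality for `S_α`. -/
noncomputable def weakConst (n : ℕ) (α : ℝ) : ℝ≥0∞ :=
  2 * (volume (ball (0 : Rn n) 1) * (16 * l2Const n α) * ((1 + 5 ^ n) * 2) + 20 ^ n +
    atomConst n α * 2)

theorem weakConst_ne_top : weakConst n α ≠ ∞ := by
  have : volume (ball (0 : Rn n) 1) ≠ ∞ := measure_ball_lt_top.ne
  have h2 := l2Const_ne_top (n := n) (α := α)
  have h3 := atomConst_ne_top (n := n) (α := α)
  unfold weakConst
  finiteness

/-- The weak `(1,1)` inequality for the intrinsic square function. -/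
theorem mul_volume_lt_S_le [NeZero n] (hα₀ : 0 < α) (hα₁ : α ≤ 1) {f : Rn n → 𝕜}
    (hf : Integrable f) {l : ℝ} (hl : 0 < l) :
    ENNReal.ofReal l * volume {x | ENNReal.ofReal l < S α f x}
      ≤ weakConst n α * ∫⁻ x, ‖f x‖ₑ := by
  obtain ⟨ι, hι, c, r, g, b, hr, hg, hgl, hgF, hb, hb0, hbsupp, hbF, hfgb, hvol⟩ :=
    exists_calderonZygmund hf (half_pos hl)
  set F := ∫⁻ x, ‖f x‖ₑ with hF
  set L := ENNReal.ofReal (l / 2) with hL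
  have hL0 : L ≠ 0 := by simpa [hL] using hl
  have hLt : L ≠ ∞ := ENNReal.ofReal_ne_top
  have hl2 : ENNReal.ofReal l = 2 * L := by
    rw [hL, show (2 : ℝ≥0∞) = ENNReal.ofReal 2 by simp, ← ENNReal.ofReal_mul (by norm_num)]
    congr 1
    ring
  have hsum : ∑' i, ∫⁻ x, ‖b i x‖ₑ ≠ ∞ :=
    ne_top_of_le_ne_top (ENNReal.mul_ne_top (by norm_num) hf.2.ne) hbF
  have hbint : Integrable fun x => ∑' i, b i x := by
    have : (fun x => ∑' i, b i x) = f - g := by rw [hfgb]; simp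
    rw [this]
    exact hf.sub hg
  -- Chebyshev's inequality with the `L²` bound, where `‖g‖₂² ≤ ‖g‖_∞ ‖g‖₁ ≲ L ‖f‖₁`.
  have h1 : L * volume {x | L ≤ S α g x}
      ≤ volume (ball (0 : Rn n) 1) * (16 * l2Const n α) * ((1 + 5 ^ n) * 2) * F := by
    have hg2 : ∫⁻ x, ‖g x‖ₑ ^ 2 ≤ (1 + 5 ^ n) * L * (2 * F) := by
      calc ∫⁻ x, ‖g x‖ₑ ^ 2 ≤ ∫⁻ x, (1 + 5 ^ n) * L * ‖g x‖ₑ := by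
            refine lintegral_mono_ae ?_
            filter_upwards [hgl] with x hx
            rw [sq]
            gcongr
        _ = (1 + 5 ^ n) * L * ∫⁻ x, ‖g x‖ₑ := lintegral_const_mul' _ _ (by finiteness)
        _ ≤ _ := by gcongr
    have hg2t : ∫⁻ x, ‖g x‖ₑ ^ 2 ≠ ∞ := by
      refine ne_top_of_le_ne_top ?_ hg2
      have := hf.2.ne
      finiteness
    have h2 : L ^ 2 * volume {x | L ≤ S α g x}
        ≤ volume (ball (0 : Rn n) 1) * (16 * l2Const n α) * ((1 + 5 ^ n) * L * (2 * F)) := by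
      have hsub : {x | L ≤ S α g x} ⊆ {x | L ^ 2 ≤ S α g x ^ 2} := fun x hx => by
        have hx' : L ≤ S α g x := hx
        exact pow_le_pow_left' hx' 2
      refine (mul_le_mul_right (measure_mono hsub) _).trans ?_
      refine (mul_meas_ge_le_lintegral
        ((measurable_S hα₀ hα₁ hg.locallyIntegrable).pow_const 2) _).trans ?_
      refine (lintegral_S_sq_le hα₀ hα₁ hg.locallyIntegrable hg2t).trans ?_
      gcongr
    refine (ENNReal.mul_le_mul_iff_right hL0 hLt).1 ?_
    rw [← mul_assoc, ← sq]
    refine h2.trans_eq ?_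
    ring
  -- The enlarged balls are discarded, since their total measure is already `≲ ‖f‖₁ / L`.
  set E : Set (Rn n) := ⋃ i, closedBall (c i) (4 * (5 * r i)) with hE
  have hEm : MeasurableSet E := MeasurableSet.iUnion fun i => measurableSet_closedBall
  have h2 : L * volume E ≤ 20 ^ n * F := by
    calc L * volume E ≤ L * ∑' i, volume (closedBall (c i) (4 * (5 * r i))) := by
          gcongr
          exact measure_iUnion_le _
      _ = 20 ^ n * (L * ∑' i, volume (closedBall (c i) (r i))) := by
          have (i : ι) : volume (closedBall (c i) (4 * (5 * r i)))
              = 20 ^ n * volume (closedBall (c i) (r i)) := by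
            have := hr i
            rw [volume_closedBall_eq _ (hr i), volume_closedBall_eq _ (by positivity),
              show 4 * (5 * r i) = 20 * r i by ring, mul_pow, ENNReal.ofReal_mul (by positivity),
              ENNReal.ofReal_pow (by norm_num), mul_assoc]
            norm_num
          simp_rw [this]
          rw [ENNReal.tsum_mul_left]
          ring
      _ ≤ _ := by gcongr
  -- Off `E` every point is far from the supports of all atoms.
  have h3 : L * volume ({x | L ≤ S α (fun x => ∑' i, b i x) x} ∩ Eᶜ) ≤ atomConst n α * 2 * F := by
    have hSm := measurable_S hα₀ hα₁ hbint.locallyIntegrable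
    rw [← Measure.restrict_apply (measurableSet_le measurable_const hSm)]
    calc _ ≤ ∫⁻ x in Eᶜ, S α (fun x => ∑' i, b i x) x := mul_meas_ge_le_lintegral hSm _
      _ ≤ ∫⁻ x in Eᶜ, ∑' i, S α (b i) x :=
          lintegral_mono fun x => S_tsum_le hα₀ hα₁ hb hsum x
      _ = ∑' i, ∫⁻ x in Eᶜ, S α (b i) x :=
          lintegral_tsum fun i => (measurable_S hα₀ hα₁ (hb i).locallyIntegrable).aemeasurable
      _ ≤ ∑' i, atomConst n α * ∫⁻ x, ‖b i x‖ₑ := by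
          refine ENNReal.tsum_le_tsum fun i => ?_
          refine (lintegral_mono_set (Set.compl_subset_compl.2
            (Set.subset_iUnion (fun i => closedBall (c i) (4 * (5 * r i))) i))).trans ?_
          exact setLIntegral_S_le_of_integral_eq_zero hα₀ (hb i) (hb0 i)
            (mul_pos (by norm_num) (hr i)) (hbsupp i)
      _ ≤ _ := by
          rw [ENNReal.tsum_mul_left, mul_assoc]
          gcongr
  have hcover : {x | ENNReal.ofReal l < S α f x} ⊆ ({x | L ≤ S α g x} ∪ E) ∪
      ({x | L ≤ S α (fun x => ∑' i, b i x) x} ∩ Eᶜ) := by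
    intro x hx
    by_contra! hcon
    simp only [Set.mem_union, Set.mem_inter_iff, Set.mem_ofPred_eq, not_or, not_and_or, not_le,
      Set.mem_compl_iff, not_not] at hcon
    obtain ⟨⟨hc1, hc2⟩, hc3⟩ := hcon
    have hc4 := hc3.resolve_right hc2
    have h5 : S α f x ≤ S α g x + S α (fun x => ∑' i, b i x) x := by
      conv_lhs => rw [hfgb]
      exact S_add_le hα₀ hα₁ hg.locallyIntegrable hbint.locallyIntegrable x
    have h6 : S α f x ≤ ENNReal.ofReal l := by
      rw [hl2, two_mul]
      exact h5.trans (add_le_add hc1.le hc4.le)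
    exact absurd hx (not_lt.2 h6)
  calc _ ≤ 2 * L * (volume {x | L ≤ S α g x} + volume E +
        volume ({x | L ≤ S α (fun x => ∑' i, b i x) x} ∩ Eᶜ)) := by
        rw [hl2] at hcover ⊢
        gcongr
        refine (measure_mono hcover).trans ((measure_union_le _ _).trans ?_)
        gcongr
        exact measure_union_le _ _
    _ = 2 * (L * volume {x | L ≤ S α g x} + L * volume E +
        L * volume ({x | L ≤ S α (fun x => ∑' i, b i x) x} ∩ Eᶜ)) := by ring
    _ ≤ 2 * (volume (ball (0 : Rn n) 1) * (16 * l2Const n α) * ((1 + 5 ^ n) * 2) * F + 20 ^ n * F +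
        atomConst n α * 2 * F) := by gcongr
    _ = _ := by
        rw [weakConst]
        ring

/-! ### Morrey spaces -/

/-- Iterating the doubling condition: `Φ` grows at most like a power with exponent `log₂ D`. -/
theorem IsGrowth.le_rpow_mul {Φ : ℝ → ℝ} {D : ℝ} (hΦ : IsGrowth Φ D) {r t : ℝ} (hr : 0 < r)
    (hrt : r ≤ t) : Φ t ≤ D * (t / r) ^ Real.logb 2 D * Φ r := by
  have hD : 0 < D := one_pos.trans_le hΦ.one_le
  have hiter (k : ℕ) : Φ (2 ^ k * r) ≤ D ^ k * Φ r := by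
    induction k with
    | zero => simp
    | succ k ih =>
      rw [pow_succ', mul_assoc, pow_succ', mul_assoc]
      exact (hΦ.doubling _ (by positivity)).trans (by gcongr)
  obtain ⟨k, hk, hk'⟩ := exists_nat_pow_near ((one_le_div hr).2 hrt) one_lt_two
  have ht : 0 < t := hr.trans_le hrt
  have hle : t ≤ 2 ^ (k + 1) * r := ((div_lt_iff₀ hr).1 hk').le
  have hpow : D ^ k ≤ (t / r) ^ Real.logb 2 D := by
    calc D ^ k = ((2 : ℝ) ^ k) ^ Real.logb 2 D := by
          rw [← Real.rpow_natCast 2 k, ← Real.rpow_mul (by norm_num), mul_comm,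
            Real.rpow_mul (by norm_num), Real.rpow_logb (by norm_num) (by norm_num) hD,
            Real.rpow_natCast]
      _ ≤ _ := Real.rpow_le_rpow (by positivity) hk
          (Real.logb_nonneg one_lt_two hΦ.one_le)
  have hΦr := hΦ.pos r hr
  calc Φ t ≤ Φ (2 ^ (k + 1) * r) :=
        hΦ.mono ht (Set.mem_Ioi.2 (by positivity)) hle
    _ ≤ D ^ (k + 1) * Φ r := hiter _
    _ = D * D ^ k * Φ r := by rw [pow_succ']
    _ ≤ _ := by gcongr

/-- The infimum defining the Morrey norm is attained. -/
theorem lintegral_ball_le_morreyNorm {Φ : ℝ → ℝ} {f : Rn n → 𝕜} (x₀ : Rn n) {r : ℝ} (hr : 0 < r)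
    (hΦ : 0 < Φ r) : ∫⁻ x in ball x₀ r, ‖f x‖ₑ ≤ morreyNorm 1 Φ f * ENNReal.ofReal (Φ r) := by
  have hΦ0 : ENNReal.ofReal (Φ r) ≠ 0 := by simpa using hΦ
  refine (ENNReal.div_le_iff hΦ0 ENNReal.ofReal_ne_top).1 (le_sInf fun C hC => ?_)
  have := hC x₀ r hr
  simp only [ENNReal.rpow_one] at this
  exact (ENNReal.div_le_iff hΦ0 ENNReal.ofReal_ne_top).2 this

/-- A function of finite weak Morrey norm is finite almost everywhere. -/
theorem ae_lt_top_of_weakMorreyNorm {Φ : ℝ → ℝ} {g : Rn n → ℝ≥0∞}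
    (h : weakMorreyNorm Φ g < ∞) : ∀ᵐ x, g x < ∞ := by
  obtain ⟨C, hC, hCt⟩ := sInf_lt_iff.1 h
  have hball (N : ℕ) : volume {x ∈ ball (0 : Rn n) (N + 1) | g x = ∞} = 0 := by
    set V := volume {x ∈ ball (0 : Rn n) (N + 1) | g x = ∞} with hV
    have hle (l : ℕ) : l * V ≤ C * ENNReal.ofReal (Φ (N + 1)) := by
      rcases Nat.eq_zero_or_pos l with rfl | hl
      · simp
      · have h1 := hC 0 (N + 1) (by positivity) l (by exact_mod_cast hl)
        rw [ENNReal.ofReal_natCast] at h1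
        refine le_trans ?_ h1
        gcongr
        exact measure_mono fun x hx => ⟨hx.1, by rw [hx.2]; exact ENNReal.natCast_lt_top l⟩
    by_contra hV0
    have hne : C * ENNReal.ofReal (Φ (N + 1)) ≠ ∞ := by finiteness
    obtain ⟨l, hl⟩ := ENNReal.exists_nat_mul_gt hV0 hne
    exact absurd (hle l) (not_le.2 hl)
  rw [ae_iff]
  refine measure_mono_null (t := ⋃ N : ℕ, {x ∈ ball (0 : Rn n) (N + 1) | g x = ∞})
    (fun x hx => ?_) (measure_iUnion_null hball)
  obtain ⟨N, hN⟩ := exists_nat_gt ‖x‖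
  exact Set.mem_iUnion.2 ⟨N, mem_ball_zero_iff.2 (by linarith), not_lt_top_iff.1 hx⟩

/-- On a ball, the square function of the part of `f` outside the double ball is bounded by the
Morrey norm. The exponent `n - log₂ D` is positive because `D < 2ⁿ`. -/
theorem S_indicator_compl_ball_le [NeZero n] (hα₀ : 0 < α) (hα₁ : α ≤ 1) {Φ : ℝ → ℝ} {D : ℝ}
    (hΦ : IsGrowth Φ D) (hD : D < 2 ^ n) {f : Rn n → 𝕜} {x₀ x : Rn n}
    {r : ℝ} (hr : 0 < r) (hx : x ∈ ball x₀ r) :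
    S α ((ball x₀ (2 * r))ᶜ.indicator f) x ≤
      (volume (ball (0 : Rn n) 1) * ENNReal.ofReal (2 * (n - Real.logb 2 D))⁻¹) ^ (1 / 2 : ℝ) *
        (morreyNorm 1 Φ f * ENNReal.ofReal (3 * D * 2 ^ n * Φ r / r ^ n)) := by
  have hD0 : 0 < D := one_pos.trans_le hΦ.one_le
  set s := Real.logb 2 D with hs
  have hβ : 0 < n - s := by
    have : s < n := by
      rw [hs, Real.logb_lt_iff_lt_rpow one_lt_two hD0, Real.rpow_natCast]
      exact hD
    linarith
  have hΦr := hΦ.pos r hr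
  have h := S_le_of_A_le (f := (ball x₀ (2 * r))ᶜ.indicator f) (x := x) (a := r / 2) (α := α)
    (β := n - s) (c := morreyNorm 1 Φ f * ENNReal.ofReal (3 * D * (2 / r) ^ s * Φ r))
    (by positivity) hβ ?_ ?_
  · refine h.trans_eq ?_
    congr 1
    rw [mul_assoc, ← ENNReal.ofReal_mul (by positivity)]
    congr 2
    have h1 : (r / 2) ^ (-(n - s)) = 2 ^ n / r ^ n * ((2 / r) ^ s)⁻¹ := by
      rw [neg_sub, Real.rpow_sub (by positivity), Real.rpow_natCast,
        ← Real.inv_rpow (by positivity), inv_div, div_pow, div_div_eq_mul_div, mul_comm,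
        mul_div_right_comm]
    rw [h1]
    have h2 : (2 / r) ^ s ≠ 0 := by positivity
    field_simp
  · intro y t ht hxy hta
    refine A_eq_zero ht fun z hz => ?_
    have hzb : z ∈ ball x₀ (2 * r) := by
      rw [mem_closedBall] at hz
      rw [mem_ball] at hx ⊢
      have h1 := dist_triangle4 z y x x₀
      rw [dist_comm y x, dist_eq_norm x y] at h1
      linarith
    have hzc : z ∉ (ball x₀ (2 * r))ᶜ := fun h => h hzb
    exact Set.indicator_of_notMem hzc _
  · intro y t hta hxy
    have ht : 0 < t := lt_trans (by positivity) hta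
    calc _ ≤ ENNReal.ofReal (3 * (t ^ n)⁻¹) *
          ∫⁻ z in closedBall y t, ‖(ball x₀ (2 * r))ᶜ.indicator f z‖ₑ :=
          A_le_setLIntegral hα₀ hα₁ _ y ht
      _ ≤ ENNReal.ofReal (3 * (t ^ n)⁻¹) * ∫⁻ z in ball y (2 * t), ‖f z‖ₑ := by
          refine mul_le_mul_right ((lintegral_mono_set
            (closedBall_subset_ball (by linarith : t < 2 * t))).trans ?_) _
          exact (lintegral_mono fun z => enorm_indicator_le_enorm_self f z)
      _ ≤ ENNReal.ofReal (3 * (t ^ n)⁻¹) *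
          (morreyNorm 1 Φ f * ENNReal.ofReal (D * (2 * t / r) ^ s * Φ r)) := by
          refine mul_le_mul_right ((lintegral_ball_le_morreyNorm y (by positivity)
            (hΦ.pos _ (by positivity))).trans ?_) _
          gcongr
          exact hΦ.le_rpow_mul hr (by linarith : r ≤ 2 * t)
      _ = _ := by
          rw [mul_left_comm, mul_assoc (morreyNorm 1 Φ f), ← ENNReal.ofReal_mul (by positivity),
            ← ENNReal.ofReal_mul (by positivity)]
          congr 2
          rw [show 2 * t / r = 2 / r * t by ring, Real.mul_rpow (by positivity) ht.le, neg_sub,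
            Real.rpow_sub ht, Real.rpow_natCast]
          ring

/-- The bound of the weak Morrey norm by the Morrey norm, with an unspecified finite constant. -/
theorem exists_weakMorreyNorm_S_le [NeZero n] (𝕜 : Type*) [RCLike 𝕜] (hα₀ : 0 < α) (hα₁ : α ≤ 1)
    {Φ : ℝ → ℝ} {D : ℝ} (hΦ : IsGrowth Φ D) (hD : D < 2 ^ n) :
    ∃ C : ℝ≥0∞, C ≠ ∞ ∧ ∀ f : Rn n → 𝕜, LocallyIntegrable f →
      weakMorreyNorm Φ (S α f) ≤ C * morreyNorm 1 Φ f := by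
  have hD0 : 0 < D := one_pos.trans_le hΦ.one_le
  set v := volume (ball (0 : Rn n) 1) with hv
  have hvt : v ≠ ∞ := measure_ball_lt_top.ne
  set W := (v * ENNReal.ofReal (2 * (n - Real.logb 2 D))⁻¹) ^ (1 / 2 : ℝ) with hW
  have hWt : W ≠ ∞ := ENNReal.rpow_ne_top_of_nonneg (by norm_num) (by finiteness)
  have hwt := weakConst_ne_top (n := n) (α := α)
  refine ⟨2 * (weakConst n α * ENNReal.ofReal D + W * v * ENNReal.ofReal (3 * D * 2 ^ n)),
    by finiteness, fun f hf => sInf_le fun x₀ r hr l hl => ?_⟩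
  set K := morreyNorm 1 Φ f with hK
  have hΦr := hΦ.pos r hr
  set f₁ := (ball x₀ (2 * r)).indicator f with hf₁
  set f₂ := (ball x₀ (2 * r))ᶜ.indicator f with hf₂
  have hf12 : f = f₁ + f₂ := (Set.indicator_self_add_compl _ _).symm
  have hf₁i : Integrable f₁ := by
    rw [hf₁, integrable_indicator_iff measurableSet_ball]
    exact (hf.integrableOn_isCompact (isCompact_closedBall x₀ (2 * r))).mono_set
      ball_subset_closedBall
  have hf₂i : LocallyIntegrable f₂ := hf.indicator measurableSet_ball.compl
  set L := ENNReal.ofReal (l / 2) with hL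
  have hl2 : ENNReal.ofReal l = 2 * L := by
    rw [hL, show (2 : ℝ≥0∞) = ENNReal.ofReal 2 by simp, ← ENNReal.ofReal_mul (by norm_num)]
    congr 1
    ring
  have h1 : L * volume {x | L < S α f₁ x}
      ≤ weakConst n α * ENNReal.ofReal D * (K * ENNReal.ofReal (Φ r)) := by
    calc _ ≤ weakConst n α * ∫⁻ x, ‖f₁ x‖ₑ := mul_volume_lt_S_le hα₀ hα₁ hf₁i (half_pos hl)
      _ = weakConst n α * ∫⁻ x in ball x₀ (2 * r), ‖f x‖ₑ := by
          simp_rw [hf₁, enorm_indicator_eq_indicator_enorm]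
          rw [lintegral_indicator measurableSet_ball]
      _ ≤ weakConst n α * (K * ENNReal.ofReal (D * Φ r)) := by
          refine mul_le_mul_right ((lintegral_ball_le_morreyNorm x₀ (by positivity)
            (hΦ.pos _ (by positivity))).trans ?_) _
          gcongr
          exact hΦ.doubling r hr
      _ = _ := by
          rw [ENNReal.ofReal_mul hD0.le]
          ring
  have h2 : L * volume {x ∈ ball x₀ r | L < S α f₂ x}
      ≤ W * v * ENNReal.ofReal (3 * D * 2 ^ n) * (K * ENNReal.ofReal (Φ r)) := by
    by_cases hex : ∃ x ∈ ball x₀ r, L < S α f₂ x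
    · obtain ⟨x, hx, hlt⟩ := hex
      calc L * volume {x ∈ ball x₀ r | L < S α f₂ x}
          ≤ W * (K * ENNReal.ofReal (3 * D * 2 ^ n * Φ r / r ^ n)) * volume (ball x₀ r) := by
            gcongr
            · exact hlt.le.trans (S_indicator_compl_ball_le hα₀ hα₁ hΦ hD hr hx)
            · exact fun x hx => hx.1
        _ = _ := by
            rw [volume_ball_eq _ hr, ← hv]
            have h3 : ENNReal.ofReal (3 * D * 2 ^ n * Φ r / r ^ n) * ENNReal.ofReal (r ^ n)
                = ENNReal.ofReal (3 * D * 2 ^ n) * ENNReal.ofReal (Φ r) := by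
              rw [← ENNReal.ofReal_mul (by positivity), ← ENNReal.ofReal_mul (by positivity),
                div_mul_cancel₀ _ (by positivity)]
            calc _ = W * v * K * (ENNReal.ofReal (3 * D * 2 ^ n * Φ r / r ^ n) *
                  ENNReal.ofReal (r ^ n)) := by ring
              _ = _ := by
                  rw [h3]
                  ring
    · have : {x ∈ ball x₀ r | L < S α f₂ x} = ∅ :=
        Set.eq_empty_of_forall_notMem fun x hx => hex ⟨x, hx.1, hx.2⟩
      rw [this]
      simp
  have hcover : {x ∈ ball x₀ r | ENNReal.ofReal l < S α f x} ⊆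
      {x | L < S α f₁ x} ∪ {x ∈ ball x₀ r | L < S α f₂ x} := by
    rintro x ⟨hx, hlx⟩
    by_cases hc : L < S α f₁ x
    · exact Or.inl hc
    · refine Or.inr ⟨hx, ?_⟩
      by_contra hc'
      refine absurd hlx (not_lt.2 ?_)
      rw [hl2, two_mul, hf12]
      exact (S_add_le hα₀ hα₁ hf₁i.locallyIntegrable hf₂i x).trans
        (add_le_add (not_lt.1 hc) (not_lt.1 hc'))
  calc _ ≤ 2 * L * (volume {x | L < S α f₁ x} + volume {x ∈ ball x₀ r | L < S α f₂ x}) := by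
        rw [hl2] at hcover ⊢
        gcongr
        exact (measure_mono hcover).trans (measure_union_le _ _)
    _ = 2 * (L * volume {x | L < S α f₁ x} + L * volume {x ∈ ball x₀ r | L < S α f₂ x}) := by ring
    _ ≤ 2 * (weakConst n α * ENNReal.ofReal D * (K * ENNReal.ofReal (Φ r)) +
        W * v * ENNReal.ofReal (3 * D * 2 ^ n) * (K * ENNReal.ofReal (Φ r))) := by gcongr
    _ = _ := by ring

end IntrinsicSquare

theorem theorem1p2 {𝕜 : Type*} [RCLike 𝕜] (n : ℕ) (α : ℝ) (hα₀ : 0 < α) (hα₁ : α ≤ 1)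
    (Φ : ℝ → ℝ) (D : ℝ) (hΦ : IntrinsicSquare.IsGrowth Φ D) (hD : D < 2 ^ n) :
    ∃ C : ℝ, 0 < C ∧ ∀ f : IntrinsicSquare.Rn n → 𝕜, IntrinsicSquare.MemMorrey 1 Φ f →
      IntrinsicSquare.MemWeakMorrey Φ (IntrinsicSquare.S α f) ∧
      IntrinsicSquare.weakMorreyNorm Φ (IntrinsicSquare.S α f)
        ≤ ENNReal.ofReal C * IntrinsicSquare.morreyNorm 1 Φ f := by
  -- In dimension `0` the hypotheses `1 ≤ D < 2 ^ n` contradict each other.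
  have : NeZero n := ⟨by
    rintro rfl
    have := hΦ.one_le
    norm_num at hD
    linarith⟩
  obtain ⟨C, hC, h⟩ := IntrinsicSquare.exists_weakMorreyNorm_S_le 𝕜 hα₀ hα₁ hΦ hD
  refine ⟨C.toReal + 1, by positivity, fun f hf => ?_⟩
  have hle : IntrinsicSquare.weakMorreyNorm Φ (IntrinsicSquare.S α f)
      ≤ ENNReal.ofReal (C.toReal + 1) * IntrinsicSquare.morreyNorm 1 Φ f := by
    refine (h f hf.1).trans ?_
    gcongr
    exact (ENNReal.le_ofReal_iff_toReal_le hC (by positivity)).2 (by linarith)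
  have hfin := hle.trans_lt (ENNReal.mul_lt_top ENNReal.ofReal_lt_top hf.2)
  exact ⟨⟨(IntrinsicSquare.measurable_S hα₀ hα₁ hf.1).aemeasurable,
    IntrinsicSquare.ae_lt_top_of_weakMorreyNorm hfin, hfin⟩, hle⟩
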